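/- Let $(Z,d)$ be a complete bounded metric space with more than one point, and let $\nu$ be a (complete Borel regular) doubling measure on $Z$: there is $C_\nu>1$ with $0<\nu(B(x,2r))\le C_\nu\,\nu(B(x,r))<\infty$ for all $x\in Z$, $r>0$, where $B(x,r)$ is the open ball. Let $Z$ be uniformly perfect at $b\in Z$ with constant $\kappa>1$: $B(b,\kappa r)\setminus B(b,r)\neq\emptyset$ whenever $r>0$ and $B(b,r)\ne Z$. Write $|x|=d(x,b)$ and $R_\infty=\sup_{x\in Z}|x|$, and fix $\sigma>0$. For a metric measure space $(X,d_X,\mu)$, a base point $p\in X$ and $m_0\in\{0,1\}$, let $$\rho_{p,m_0}(x)=\frac{1}{m(x)\,\mu(B_X(p,m(x)))^{1/\sigma}},\qquad m(x)=d_X(x,p)+m_0,$$ with $\rho_{p,0}(p)=\infty$, and on $X'=\{x\in X:\rho_{p,m_0}(x)<\infty\}$ consider the measure $\rho_{p,m_0}^{\sigma}\,d\mu$ and the metric $$(x,y)\mapsto\inf\sum_{j=1}^{n}\bigl(\rho_{p,m_0}(x_j)+\rho_{p,m_0}(x_{j-1})\bigr)\,d_X(x_j,x_{j-1}),$$ where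 the infimum is over all finite chains $x=x_0,x_1,\dots,x_n=y$ in $X$. For $m_0=0$ this is the flattening of $X$ at $p$. For $m_0=1$ the metric completion, with the measure extended by zero to the added points, is the sphericalization of $X$ with base point $p$. Let $(Z\setminus\{b\},\hat d,\hat\nu)$ be the flattening of $(Z,d,\nu)$ at $b$, let $\hat b\in Z\setminus\{b\}$, and let $(\widetilde Z,\tilde d,\tilde\nu)$ be the sphericalization of $(Z\setminus\{b\},\hat d,\hat\nu)$ with base point $\hat b$. Then the completion adds exactly one point $\infty$ to $Z\setminus\{b\}$, and identifying $\infty$ with $b$ gives a homeomorphism $Z\to\widetilde Z$ that is the identity on $Z\setminus\{b\}$. With this identification, $$\tfrac1C\,d(x,y)\le\tilde d(x,y)\le C\,d(x,y)\quad\text{for all }x,y\in Z,$$ $$\tfrac1C\,\nu(E)\le\tilde\nu(E)\le C\,\nu(E)\quad\text{for all Borel sets }E\subseteq Z,$$ where the constant $C>0$ depends only on $C_\nu$, $\kappa$, $\sigma$, $R_\infty$, $\nu(Z)$ and $|\hat b|$. -/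

import Mathlib

open MeasureTheory Set Metric
open scoped ENNReal

noncomputable section

/-- The deformed distance associated with a density `w`: the infimum of
`∑ (w (x_j) + w (x_{j-1})) * d (x_j, x_{j-1})` over all finite chains
`x = x_0, x_1, …, x_n = y` in `X`. It is computed in `[0, ∞]`, as `w` may take the value `∞`. -/
def deformedEDist {X : Type*} [PseudoMetricSpace X] (w : X → ℝ≥0∞) (x y : X) : ℝ≥0∞ :=
  ⨅ (n : ℕ) (c : ℕ → X) (_ : c 0 = x) (_ : c n = y),
    ∑ j ∈ Finset.range n, (w (c (j + 1)) + w (c j)) * edist (c (j + 1)) (c j)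

section deformedEDist

variable {X : Type*} [PseudoMetricSpace X] (w : X → ℝ≥0∞)

theorem deformedEDist_le_sum (c : ℕ → X) (n : ℕ) :
    deformedEDist w (c 0) (c n) ≤
      ∑ j ∈ Finset.range n, (w (c (j + 1)) + w (c j)) * edist (c (j + 1)) (c j) :=
  iInf_le_of_le n (iInf_le_of_le c (iInf_le_of_le rfl (iInf_le_of_le rfl le_rfl)))

theorem deformedEDist_self (x : X) : deformedEDist w x x = 0 := by
  have h := deformedEDist_le_sum w (fun _ => x) 0
  simpa using h

theorem deformedEDist_le (x y : X) :
    deformedEDist w x y ≤ (w y + w x) * edist y x := by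
  have h := deformedEDist_le_sum w (fun n => if n = 0 then x else y) 1
  simpa using h

theorem deformedEDist_comm_le (x y : X) : deformedEDist w x y ≤ deformedEDist w y x := by
  refine le_iInf fun n => le_iInf fun c => le_iInf fun h0 => le_iInf fun hn => ?_
  have h := deformedEDist_le_sum w (fun j => c (n - j)) n
  simp only [Nat.sub_zero, Nat.sub_self, h0, hn] at h
  refine h.trans (le_of_eq ?_)
  rw [← Finset.sum_range_reflect]
  refine Finset.sum_congr rfl fun j hj => ?_
  have hj' := Finset.mem_range.1 hj
  have e1 : n - (n - 1 - j + 1) = j := by omega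
  have e2 : n - (n - 1 - j) = j + 1 := by omega
  rw [e1, e2, edist_comm, add_comm]

theorem deformedEDist_comm (x y : X) : deformedEDist w x y = deformedEDist w y x :=
  le_antisymm (deformedEDist_comm_le w x y) (deformedEDist_comm_le w y x)

theorem deformedEDist_triangle (x y z : X) :
    deformedEDist w x z ≤ deformedEDist w x y + deformedEDist w y z := by
  have key : ∀ (n : ℕ) (c : ℕ → X), c 0 = x → c n = y → ∀ (m : ℕ) (e : ℕ → X), e 0 = y → e m = z →
      deformedEDist w x z ≤
        (∑ j ∈ Finset.range n, (w (c (j + 1)) + w (c j)) * edist (c (j + 1)) (c j)) +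
        ∑ j ∈ Finset.range m, (w (e (j + 1)) + w (e j)) * edist (e (j + 1)) (e j) := by
    intro n c hc0 hcn m e he0 hem
    set f : ℕ → X := fun j => if j ≤ n then c j else e (j - n) with hf
    have f1 : ∀ j, j ≤ n → f j = c j := fun j hj => by simp [hf, hj]
    have f2 : ∀ j, f (n + j) = e j := by
      intro j
      rcases Nat.eq_zero_or_pos j with rfl | hj
      · simp [hf, hcn, he0]
      · have : ¬ (n + j ≤ n) := by omega
        simp [hf, this]
    have h := deformedEDist_le_sum w f (n + m)
    rw [f1 0 (Nat.zero_le _), f2 m, hc0, hem, Finset.sum_range_add] at h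
    refine h.trans (le_of_eq ?_)
    congr 1
    · refine Finset.sum_congr rfl fun j hj => ?_
      have hj' := Finset.mem_range.1 hj
      rw [f1 j (by omega), f1 (j + 1) (by omega)]
    · refine Finset.sum_congr rfl fun j _ => ?_
      rw [add_assoc, f2, f2]
  conv_rhs => rw [deformedEDist, deformedEDist]
  simp only [ENNReal.iInf_add, ENNReal.add_iInf]
  refine le_iInf fun n => le_iInf fun c => le_iInf fun h0 => le_iInf fun hn =>
    le_iInf fun m => le_iInf fun e => le_iInf fun h0' => le_iInf fun hm => ?_
  exact key _ _ ‹_› ‹_› _ _ ‹_› ‹_›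

end deformedEDist

/-- The set of points of `X` at which the density `w` is finite. For a density that is infinite
exactly at a base point `b` this is `X \ {b}`, for a finite density it is `X`. -/
structure Deformed {X : Type*} (w : X → ℝ≥0∞) where
  val : X
  ne_top : w val ≠ ∞

theorem deformedEDist_ne_top {X : Type*} [PseudoMetricSpace X] (w : X → ℝ≥0∞)
    (x y : Deformed w) : deformedEDist w x.val y.val ≠ ∞ :=
  ne_top_of_le_ne_top
    (ENNReal.mul_ne_top (ENNReal.add_ne_top.2 ⟨y.ne_top, x.ne_top⟩) (edist_ne_top _ _))
    (deformedEDist_le w x.val y.val)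

/-- `Deformed w` carries the deformed distance. -/
instance {X : Type*} [PseudoMetricSpace X] (w : X → ℝ≥0∞) : PseudoMetricSpace (Deformed w) where
  dist x y := (deformedEDist w x.val y.val).toReal
  dist_self x := by rw [deformedEDist_self, ENNReal.toReal_zero]
  dist_comm x y := by rw [deformedEDist_comm]
  dist_triangle x y z := by
    rw [← ENNReal.toReal_add (deformedEDist_ne_top w x y) (deformedEDist_ne_top w y z)]
    exact ENNReal.toReal_mono
      (ENNReal.add_ne_top.2 ⟨deformedEDist_ne_top w x y, deformedEDist_ne_top w y z⟩)
      (deformedEDist_triangle w _ _ _)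

/-- `Deformed w` carries the σ-algebra of a subset of `X`: the deformations used below do not
change the topology, so there is only one Borel σ-algebra on it. -/
instance {X : Type*} [MeasurableSpace X] (w : X → ℝ≥0∞) : MeasurableSpace (Deformed w) :=
  MeasurableSpace.comap Deformed.val inferInstance

/-- The measure `w ^ σ dμ` on `Deformed w`. -/
def deformedMeasure {X : Type*} [MeasurableSpace X] (w : X → ℝ≥0∞) (μ : Measure X) (σ : ℝ) :
    Measure (Deformed w) :=
  (μ.withDensity fun x => w x ^ σ).comap Deformed.val

/-- The metric density `1 / (m(x) μ(B(b, m(x))) ^ (1/σ))` with `m(x) = d(x, b) + m₀`.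
For `m₀ = 0` its value at `b` is `1 / 0 = ∞`. -/
def metricDensity {X : Type*} [PseudoMetricSpace X] [MeasurableSpace X]
    (b : X) (μ : Measure X) (m₀ σ : ℝ) (x : X) : ℝ≥0∞ :=
  (ENNReal.ofReal (dist x b + m₀) * μ (ball b (dist x b + m₀)) ^ (1 / σ))⁻¹

/-- The flattening of `(X, d, μ)` at `b`: the metric space obtained from the density with `m₀ = 0`,
in which the point `b` is removed. -/
abbrev Flattening {X : Type*} [PseudoMetricSpace X] [MeasurableSpace X]
    (b : X) (μ : Measure X) (σ : ℝ) : Type _ :=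
  Deformed (metricDensity b μ 0 σ)

/-- The measure of the flattening. -/
abbrev flatteningMeasure {X : Type*} [PseudoMetricSpace X] [MeasurableSpace X]
    (b : X) (μ : Measure X) (σ : ℝ) : Measure (Flattening b μ σ) :=
  deformedMeasure (metricDensity b μ 0 σ) μ σ

/-- The space `X` with the metric obtained from the density with `m₀ = 1`,
before it is completed. -/
abbrev PreSphericalization {X : Type*} [PseudoMetricSpace X] [MeasurableSpace X]
    (b : X) (μ : Measure X) (σ : ℝ) : Type _ :=
  Deformed (metricDensity b μ 1 σ)

/-- The sphericalization of `(X, d, μ)` with base point `b`: the metric completion of `X`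
with respect to the metric obtained from the density with `m₀ = 1`. -/
abbrev Sphericalization {X : Type*} [PseudoMetricSpace X] [MeasurableSpace X]
    (b : X) (μ : Measure X) (σ : ℝ) : Type _ :=
  UniformSpace.Completion (PreSphericalization b μ σ)

/-- The completion of a deformed space carries its Borel σ-algebra. -/
instance {X : Type*} [PseudoMetricSpace X] (w : X → ℝ≥0∞) :
    MeasurableSpace (UniformSpace.Completion (Deformed w)) :=
  borel _

/-- The measure of the sphericalization: `ρ ^ σ dμ` on `X`, and zero on the points that the
completion adds. -/
def sphericalizationMeasure {X : Type*} [PseudoMetricSpace X] [MeasurableSpace X]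
    (b : X) (μ : Measure X) (σ : ℝ) : Measure (Sphericalization b μ σ) :=
  (deformedMeasure (metricDensity b μ 1 σ) μ σ).map
    ((↑) : PreSphericalization b μ σ → Sphericalization b μ σ)

/-- `μ` is a doubling measure with doubling constant `C`. -/
def IsDoublingWith {X : Type*} [PseudoMetricSpace X] [MeasurableSpace X]
    (μ : Measure X) (C : ℝ) : Prop :=
  1 < C ∧ ∀ (x : X) (r : ℝ), 0 < r →
    0 < μ (ball x (2 * r)) ∧ μ (ball x (2 * r)) ≤ ENNReal.ofReal C * μ (ball x r) ∧
      ENNReal.ofReal C * μ (ball x r) < ∞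

/-- `X` is uniformly perfect at the point `b` with constant `κ`. -/
def IsUniformlyPerfectAt {X : Type*} [PseudoMetricSpace X] (b : X) (κ : ℝ) : Prop :=
  1 < κ ∧ ∀ r : ℝ, 0 < r → ball b r ≠ univ → (ball b (κ * r) \ ball b r).Nonempty

end

/-! Write |x| = d(x,b) and u(r) = ν(B(b,r))^(1/σ), the gauge. The first density is 1/(|x| u(|x|)).
The heart of the proof is that the second density, computed in the flattened space, is comparable to
|x| u(|x|). The two densities then cancel up to constants, in the metric and in the measure.

Uniform perfectness at b gives points in every annulus around b. With doubling this yields reverse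
doubling: u grows at least by a factor 2 when the radius grows by some factor Λ. Chains that jump
from annulus to annulus therefore have geometrically decaying cost, and the flattened distance
satisfies d̂(x,y) ≲ 1/u(|x|) for |x| ≤ |y| (`flat_dist_le_of_le`). A truncated distance function
gives a matching lower bound (`le_flat_dist`). Hence d̂(x,b̂) + 1 ≈ 1/u(|x|), so the ball of that
radius around b̂ lies in some region |y| ≥ c|x|, and for x close to b it contains another region of
this form. The flattened measure of such a region is ≈ |x|^(-σ), by a geometric series over dyadic
annuli from above and by one ball of radius ≈ |x| from below; for x away from b, a fixed ball around
b̂ suffices. Multiplying radius and measure gives the second density (`isBalanced`).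

For the metrics, one step satisfies d(x,y) ≲ (q(x) + q(y)) d̂(x,y), where q is the second density;
summing over chains bounds d by d̃. Conversely, points at comparable distance from b are joined by
one step, and others by a chain approaching b whose costs decay like |·|. So d ≈ d̃ on Z \ {b}.
Since b is not isolated and Z is complete, Z is a completion of Z \ {b} for d̃. The measures agree
up to constants because ν({b}) = 0. -/

noncomputable section

/-! ### Bounds for a general deformed distance -/

section Deformed

variable {X : Type*} [PseudoMetricSpace X] {w : X → ℝ≥0∞}

theorem Deformed.dist_eq (x y : Deformed w) :
    dist x y = (deformedEDist w x.val y.val).toReal := rfl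

theorem Deformed.dist_le (x y : Deformed w) :
    dist x y ≤ ((w x.val).toReal + (w y.val).toReal) * dist x.val y.val := by
  rw [Deformed.dist_eq, dist_edist, ← ENNReal.toReal_add x.ne_top y.ne_top, ← ENNReal.toReal_mul]
  refine ENNReal.toReal_mono (ENNReal.mul_ne_top (ENNReal.add_ne_top.2 ⟨x.ne_top, y.ne_top⟩)
    (edist_ne_top _ _)) ?_
  rw [add_comm, edist_comm]
  exact deformedEDist_le w x.val y.val

/-- The triangle inequality in the target turns a bound on single steps into a bound on every chain.
Lower bounds for deformed distances come from this, applied to real-valued test functions. -/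
theorem edist_le_deformedEDist {Y : Type*} [PseudoEMetricSpace Y] (φ : X → Y)
    (h : ∀ a c, edist (φ a) (φ c) ≤ (w a + w c) * edist a c) (x y : X) :
    edist (φ x) (φ y) ≤ deformedEDist w x y := by
  refine le_iInf fun n => le_iInf fun c => le_iInf fun h0 => le_iInf fun hn => ?_
  rw [← h0, ← hn]
  refine (edist_le_range_sum_edist (fun j => φ (c j)) n).trans (Finset.sum_le_sum fun j _ => ?_)
  rw [edist_comm]
  exact h _ _

/-- A map that is controlled on single steps is controlled by the deformed distance. -/
theorem Deformed.le_dist {Y : Type*} [PseudoMetricSpace Y] (φ : X → Y)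
    (h0 : ∀ a c, dist a c = 0 → dist (φ a) (φ c) = 0)
    (h : ∀ a c, w a ≠ ∞ → w c ≠ ∞ →
      dist (φ a) (φ c) ≤ ((w a).toReal + (w c).toReal) * dist a c)
    (x y : Deformed w) : dist (φ x.val) (φ y.val) ≤ dist x y := by
  rw [Deformed.dist_eq, dist_edist]
  refine ENNReal.toReal_mono (deformedEDist_ne_top w x y)
    (edist_le_deformedEDist φ (fun a c => ?_) _ _)
  -- In `ℝ≥0∞` a step of length zero costs `∞ * 0 = 0` even at infinite weight, hence the separate
  -- hypothesis `h0`. A step of positive length at infinite weight costs `∞` and imposes nothing.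
  by_cases hac : dist a c = 0
  · rw [edist_dist, h0 a c hac]; simp
  have hac' : edist a c ≠ 0 := by
    rw [edist_dist]; simpa using lt_of_le_of_ne dist_nonneg (Ne.symm hac)
  by_cases hw : w a + w c = ∞
  · rw [hw, ENNReal.top_mul hac']; exact le_top
  obtain ⟨ha, hc⟩ := ENNReal.add_ne_top.1 hw
  rw [← ENNReal.toReal_le_toReal (edist_ne_top _ _) (ENNReal.mul_ne_top hw (edist_ne_top _ _)),
    ENNReal.toReal_mul, ENNReal.toReal_add ha hc, ← dist_edist, ← dist_edist]
  exact h a c ha hc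

end Deformed

/-! ### Doubling, and reverse doubling at a point -/

section Doubling

variable {X : Type*} [PseudoMetricSpace X] [MeasurableSpace X] {μ : Measure X} {C : ℝ}

theorem IsDoublingWith.ball_ne_top (h : IsDoublingWith μ C) (x : X) (r : ℝ) :
    μ (ball x r) ≠ ∞ := by
  rcases le_or_gt r 0 with hr | hr
  · simp [ball_eq_empty.2 hr]
  have := (h.2 x r hr).2.2
  intro htop
  rw [htop, ENNReal.mul_top (by simpa using by linarith [h.1])] at this
  exact lt_irrefl _ this

theorem IsDoublingWith.ball_pos (h : IsDoublingWith μ C) (x : X) {r : ℝ} (hr : 0 < r) :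
    0 < μ (ball x r) := by
  have := (h.2 x (r / 2) (by positivity)).1
  rwa [mul_div_cancel₀ _ (two_ne_zero)] at this

theorem IsDoublingWith.real_ball_pos (h : IsDoublingWith μ C) (x : X) {r : ℝ} (hr : 0 < r) :
    0 < μ.real (ball x r) :=
  ENNReal.toReal_pos (h.ball_pos x hr).ne' (h.ball_ne_top x r)

theorem IsDoublingWith.real_ball_mono (h : IsDoublingWith μ C) {x y : X} {r s : ℝ}
    (hrs : ball x r ⊆ ball y s) : μ.real (ball x r) ≤ μ.real (ball y s) :=
  measureReal_mono hrs (h.ball_ne_top y s)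

theorem IsDoublingWith.real_ball_two_mul_le (h : IsDoublingWith μ C) (x : X) {r : ℝ} (hr : 0 < r) :
    μ.real (ball x (2 * r)) ≤ C * μ.real (ball x r) := by
  have h1 := (h.2 x r hr).2
  have h2 := ENNReal.toReal_mono h1.2.ne h1.1
  rwa [ENNReal.toReal_mul, ENNReal.toReal_ofReal (by linarith [h.1])] at h2

theorem IsDoublingWith.real_ball_le (h : IsDoublingWith μ C) (x : X) {r s : ℝ} (hr : 0 < r) {n : ℕ}
    (hs : s ≤ 2 ^ n * r) : μ.real (ball x s) ≤ C ^ n * μ.real (ball x r) := by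
  refine (h.real_ball_mono (ball_subset_ball hs)).trans ?_
  clear hs
  induction n with
  | zero => simp
  | succ n ih =>
    have h1 := h.real_ball_two_mul_le x (r := 2 ^ n * r) (by positivity)
    have hC := h.1
    calc μ.real (ball x (2 ^ (n + 1) * r)) = μ.real (ball x (2 * (2 ^ n * r))) := by ring_nf
      _ ≤ C * μ.real (ball x (2 ^ n * r)) := h1
      _ ≤ C * (C ^ n * μ.real (ball x r)) := by gcongr
      _ = _ := by ring

/-- Reverse doubling at a point of uniform perfectness. -/
theorem IsDoublingWith.exists_reverse (C κ σ : ℝ) (hC : 1 < C) (hκ : 1 < κ) :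
    ∃ Λ : ℝ, 2 ≤ Λ ∧ ∀ {X : Type*} [PseudoMetricSpace X] [MeasurableSpace X] [OpensMeasurableSpace X]
      {μ : Measure X} (_ : IsDoublingWith μ C) (b : X) (R : ℝ)
      (_ : ∀ r, 0 < r → r < R → ∃ x, r ≤ dist x b ∧ dist x b < κ * r) (r : ℝ),
      0 < r → Λ * r ≤ R → 2 ^ σ * μ.real (ball b r) ≤ μ.real (ball b (Λ * r)) := by
  obtain ⟨n, hn⟩ := pow_unbounded_of_one_lt (2 * (κ + 1)) (one_lt_two : (1 : ℝ) < 2)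
  have hc : 0 < (C ^ n)⁻¹ := by positivity
  -- Each enlargement by τ gains the factor `1 + C⁻ⁿ`; N enlargements gain `2 ^ σ`, which becomes 2
  -- after taking the `1 / σ`-th power. The exponent `N + 1` used below keeps `Λ ≥ 2` even if `N =
  -- 0`.
  obtain ⟨N, hN⟩ := pow_unbounded_of_one_lt ((2 : ℝ) ^ σ) (by linarith : 1 < 1 + (C ^ n)⁻¹)
  set τ := 2 * (κ + 1) with hτ
  have hτ4 : 4 ≤ τ := by linarith
  refine ⟨τ ^ (N + 1), ?_, ?_⟩
  · calc (2 : ℝ) ≤ τ := by linarith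
      _ ≤ τ ^ (N + 1) := le_self_pow₀ (by linarith) (by simp)
  intro X _ _ _ μ h b R hR r hr hrR
  have step : ∀ t, 0 < t → τ * t ≤ R →
      (1 + (C ^ n)⁻¹) * μ.real (ball b t) ≤ μ.real (ball b (τ * t)) := by
    intro t ht htR
    -- The ball of radius t around this x is disjoint from `ball b t`, lies in `ball b (τ * t)`, and
    -- by doubling carries a fixed fraction of the measure of `ball b t`.
    obtain ⟨x, hx1, hx2⟩ := hR (2 * t) (by positivity) (by nlinarith)
    have h1 : μ.real (ball b t) ≤ C ^ n * μ.real (ball x t) := by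
      refine le_trans (h.real_ball_mono (ball_subset_ball' (y := x) (ε₂ := 2 ^ n * t) ?_))
        (h.real_ball_le x ht le_rfl)
      rw [dist_comm b x]; nlinarith
    have hdisj : Disjoint (ball b t) (ball x t) := by
      apply ball_disjoint_ball; rw [dist_comm b x]; linarith
    have h2 : μ.real (ball b t) + μ.real (ball x t) ≤ μ.real (ball b (τ * t)) := by
      rw [← measureReal_union hdisj measurableSet_ball (h.ball_ne_top _ _) (h.ball_ne_top _ _)]
      refine measureReal_mono (union_subset (ball_subset_ball (by nlinarith))
        (ball_subset_ball' ?_)) (h.ball_ne_top _ _)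
      nlinarith
    have h3 : (C ^ n)⁻¹ * μ.real (ball b t) ≤ μ.real (ball x t) := by
      rw [inv_mul_le_iff₀ (by positivity)]; exact h1
    linarith
  have iter : ∀ k : ℕ, τ ^ k * r ≤ R →
      (1 + (C ^ n)⁻¹) ^ k * μ.real (ball b r) ≤ μ.real (ball b (τ ^ k * r)) := by
    intro k
    induction k with
    | zero => simp
    | succ k ih =>
      intro hk
      have e : τ ^ (k + 1) * r = τ * (τ ^ k * r) := by ring
      rw [e] at hk ⊢
      have h0 : 0 < τ ^ k * r := by positivity
      calc (1 + (C ^ n)⁻¹) ^ (k + 1) * μ.real (ball b r)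
          = (1 + (C ^ n)⁻¹) * ((1 + (C ^ n)⁻¹) ^ k * μ.real (ball b r)) := by ring
        _ ≤ (1 + (C ^ n)⁻¹) * μ.real (ball b (τ ^ k * r)) := by
            gcongr; exact ih (by nlinarith)
        _ ≤ _ := step _ h0 hk
  refine le_trans ?_ (iter (N + 1) hrR)
  gcongr
  refine hN.le.trans (pow_le_pow_right₀ (by linarith) (Nat.le_succ N))

end Doubling

/-! ### The gauge and the quantitative hypotheses -/

/-- The `1 / σ`-th power of the measure of the ball of radius `r` around `b`. -/
def ballGauge {X : Type*} [PseudoMetricSpace X] [MeasurableSpace X] (b : X) (μ : Measure X)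
    (σ r : ℝ) : ℝ := μ.real (ball b r) ^ (1 / σ)

theorem metricDensity_eq_ofReal {X : Type*} [PseudoMetricSpace X] [MeasurableSpace X] {b : X}
    {μ : Measure X} {m₀ : ℝ} (σ : ℝ) {x : X} (hm : 0 < dist x b + m₀)
    (h0 : μ (ball b (dist x b + m₀)) ≠ 0) (htop : μ (ball b (dist x b + m₀)) ≠ ∞) :
    metricDensity b μ m₀ σ x =
      ENNReal.ofReal ((dist x b + m₀) * ballGauge b μ σ (dist x b + m₀))⁻¹ := by
  have hpos : 0 < μ.real (ball b (dist x b + m₀)) := ENNReal.toReal_pos h0 htop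
  rw [metricDensity, ballGauge, ENNReal.ofReal_inv_of_pos (by positivity),
    ENNReal.ofReal_mul hm.le, ← ENNReal.ofReal_rpow_of_pos hpos, Measure.real,
    ENNReal.ofReal_toReal htop]

/-- The reciprocal of the density is a monotone function of `dist x b`, and monotone functions of a
real variable are Borel. -/
theorem measurable_metricDensity_zero {X : Type*} [PseudoMetricSpace X] [MeasurableSpace X]
    [OpensMeasurableSpace X] (b : X) (μ : Measure X) {σ : ℝ} (hσ : 0 < σ) :
    Measurable (metricDensity b μ 0 σ) := by
  have : Monotone fun t : ℝ => ENNReal.ofReal (t + 0) * μ (ball b (t + 0)) ^ (1 / σ) := by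
    intro s t hst
    have : ball b (s + 0) ⊆ ball b (t + 0) := ball_subset_ball (by linarith)
    dsimp only
    gcongr
  exact (this.measurable.comp (by fun_prop : Continuous fun x : X => dist x b).measurable).inv

/-- Quantitative data of a bounded space with a measure that is doubling, and reverse doubling
at `b`, in terms of the gauge `r ↦ ν(B(b, r)) ^ (1 / σ)`. -/
structure IsGauged {Z : Type*} [MetricSpace Z] [MeasurableSpace Z]
    (C κ σ R U A Λ : ℝ) (ν : Measure Z) (b : Z) : Prop where
  doubling : IsDoublingWith ν C
  sigma_pos : 0 < σ
  kappa : 1 < κ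
  R_pos : 0 < R
  A_eq : A = C ^ (1 / σ)
  two_le : 2 ≤ Λ
  dist_le : ∀ x, dist x b ≤ R
  annulus : ∀ r, 0 < r → r < R → ∃ x, r ≤ dist x b ∧ dist x b < κ * r
  reverse : ∀ r, 0 < r → Λ * r ≤ R → 2 * ballGauge b ν σ r ≤ ballGauge b ν σ (Λ * r)
  top : ∀ r, R < r → ballGauge b ν σ r = U

/-- Λ is fixed before the space, so later constants depend on the data alone. No ball around b of
radius below R is the whole space, because R is a supremum, so uniform perfectness applies at all
these radii. -/
theorem IsDoublingWith.exists_isGauged (C κ σ R V : ℝ) (hσ : 0 < σ) (hC : 1 < C) (hκ : 1 < κ) :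
    ∃ Λ : ℝ, ∀ {Z : Type*} [MetricSpace Z] [Nontrivial Z] [MeasurableSpace Z] [BorelSpace Z]
      {ν : Measure Z} {b : Z}, IsDoublingWith ν C → IsUniformlyPerfectAt b κ →
      IsLUB (range fun x : Z => dist x b) R → ν univ = ENNReal.ofReal V →
      IsGauged C κ σ R (V ^ (1 / σ)) (C ^ (1 / σ)) Λ ν b := by
  obtain ⟨Λ, hΛ, hrev⟩ := IsDoublingWith.exists_reverse C κ σ hC hκ
  refine ⟨Λ, ?_⟩
  intro Z _ _ _ _ ν b hD hP hR hV
  have hle : ∀ x, dist x b ≤ R := fun x => hR.1 ⟨x, rfl⟩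
  have hann : ∀ r, 0 < r → r < R → ∃ x, r ≤ dist x b ∧ dist x b < κ * r := by
    intro r hr hrR
    have hne : ball b r ≠ univ := by
      intro hu
      refine absurd (hR.2 (?_ : r ∈ upperBounds _)) (not_le.2 hrR)
      rintro _ ⟨x, rfl⟩
      exact (mem_ball.1 (hu ▸ mem_univ x : x ∈ ball b r)).le
    obtain ⟨x, hx1, hx2⟩ := hP.2 r hr hne
    exact ⟨x, by simpa using hx2, hx1⟩
  have hR0 : 0 < R := by
    obtain ⟨y, hy⟩ := exists_ne b
    exact (dist_pos.2 hy).trans_le (hle y)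
  refine ⟨hD, hσ, hκ, hR0, rfl, hΛ, hle, hann, fun r hr hrR => ?_, fun r hr => ?_⟩
  · have h := hrev hD b R hann r hr hrR
    have h2 : (2 : ℝ) = ((2 : ℝ) ^ σ) ^ (1 / σ) := by
      rw [← Real.rpow_mul (by norm_num), mul_one_div_cancel hσ.ne', Real.rpow_one]
    rw [ballGauge, ballGauge]
    conv_lhs => rw [h2]
    rw [← Real.mul_rpow (by positivity) measureReal_nonneg]
    exact Real.rpow_le_rpow (by positivity) h (by positivity)
  · have hu : ball b r = univ := eq_univ_of_forall fun x => mem_ball.2 ((hle x).trans_lt hr)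
    have hV0 : 0 < V := by
      have h0 := hD.ball_pos b (hR0.trans hr)
      rw [hu, hV] at h0
      simpa using h0
    rw [ballGauge, hu, Measure.real, hV, ENNReal.toReal_ofReal hV0.le]

/-! ### The gauge and the flattened distance -/

namespace IsGauged

variable {Z : Type*} [MetricSpace Z] [MeasurableSpace Z] {C κ σ R U A Λ : ℝ} {ν : Measure Z} {b : Z}

local notation "u" => ballGauge b ν σ

theorem mono (h : IsGauged C κ σ R U A Λ ν b) {r s : ℝ} (hrs : r ≤ s) : u r ≤ u s :=
  Real.rpow_le_rpow measureReal_nonneg (h.doubling.real_ball_mono (ball_subset_ball hrs))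
    (by have := h.sigma_pos; positivity)

theorem pos (h : IsGauged C κ σ R U A Λ ν b) {r : ℝ} (hr : 0 < r) : 0 < u r :=
  Real.rpow_pos_of_pos (h.doubling.real_ball_pos b hr) _

theorem rpow_eq (h : IsGauged C κ σ R U A Λ ν b) (r : ℝ) : u r ^ σ = ν.real (ball b r) := by
  rw [ballGauge, ← Real.rpow_mul measureReal_nonneg, one_div_mul_cancel h.sigma_pos.ne',
    Real.rpow_one]

theorem one_le_A (h : IsGauged C κ σ R U A Λ ν b) : 1 ≤ A := by
  rw [h.A_eq]
  exact Real.one_le_rpow h.doubling.1.le (by have := h.sigma_pos; positivity)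

theorem le_two_pow (h : IsGauged C κ σ R U A Λ ν b) {r s : ℝ} (hr : 0 < r) {n : ℕ}
    (hs : s ≤ 2 ^ n * r) : u s ≤ A ^ n * u r := by
  have hσ := h.sigma_pos
  have hC : 0 ≤ C := by linarith [h.doubling.1]
  rw [h.A_eq, ← Real.rpow_natCast (C ^ (1 / σ)), ← Real.rpow_mul hC, mul_comm (1 / σ),
    Real.rpow_mul hC, ballGauge, ballGauge, Real.rpow_natCast,
    ← Real.mul_rpow (by positivity) measureReal_nonneg]
  exact Real.rpow_le_rpow measureReal_nonneg (h.doubling.real_ball_le b hr hs) (by positivity)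

theorem le_top (h : IsGauged C κ σ R U A Λ ν b) (r : ℝ) : u r ≤ U := by
  have h1 := h.top (max r (R + 1)) (lt_of_lt_of_le (by linarith) (le_max_right _ _))
  rw [← h1]
  exact h.mono (le_max_left _ _)

theorem U_pos (h : IsGauged C κ σ R U A Λ ν b) : 0 < U :=
  (h.pos one_pos).trans_le (h.le_top 1)

theorem reverse_pow (h : IsGauged C κ σ R U A Λ ν b) {r : ℝ} (hr : 0 < r) (n : ℕ)
    (hn : Λ ^ n * r ≤ R) : 2 ^ n * u r ≤ u (Λ ^ n * r) := by
  have hΛ := h.two_le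
  induction n with
  | zero => simp
  | succ n ih =>
    have e : Λ ^ (n + 1) * r = Λ * (Λ ^ n * r) := by ring
    rw [e] at hn ⊢
    have h0 : 0 < Λ ^ n * r := by positivity
    have h1 := h.reverse _ h0 hn
    have h2 := ih (by nlinarith)
    calc 2 ^ (n + 1) * u r = 2 * (2 ^ n * u r) := by ring
      _ ≤ 2 * u (Λ ^ n * r) := by gcongr
      _ ≤ _ := h1

theorem metricDensity_eq (h : IsGauged C κ σ R U A Λ ν b) {x : Z} (hx : x ≠ b) :
    metricDensity b ν 0 σ x = ENNReal.ofReal (dist x b * u (dist x b))⁻¹ := by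
  have h0 : 0 < dist x b := dist_pos.2 hx
  have := metricDensity_eq_ofReal (b := b) (μ := ν) (m₀ := 0) σ (x := x) (by simpa using h0)
    (h.doubling.ball_pos b (by simpa using h0)).ne' (h.doubling.ball_ne_top b _)
  simpa using this

theorem metricDensity_self : metricDensity b ν 0 σ b = ∞ := by
  simp [metricDensity]

theorem metricDensity_ne_top_iff (h : IsGauged C κ σ R U A Λ ν b) {x : Z} :
    metricDensity b ν 0 σ x ≠ ∞ ↔ x ≠ b := by
  refine ⟨fun hx hxb => hx (hxb ▸ metricDensity_self), fun hx => ?_⟩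
  rw [h.metricDensity_eq hx]
  exact ENNReal.ofReal_ne_top

theorem dist_pos (x : Flattening b ν σ) : 0 < dist x.val b :=
  _root_.dist_pos.2 fun hx => x.ne_top (by rw [hx]; exact metricDensity_self)

/-- At b the formula survives through default values: `∞.toReal = 0` and `0⁻¹ = 0`. -/
theorem toReal_metricDensity (h : IsGauged C κ σ R U A Λ ν b) (x : Z) :
    (metricDensity b ν 0 σ x).toReal = (dist x b * u (dist x b))⁻¹ := by
  by_cases hx : x = b
  · simp [hx, metricDensity_self]
  rw [h.metricDensity_eq hx, ENNReal.toReal_ofReal]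
  have := h.pos (_root_.dist_pos.2 hx)
  positivity

theorem density_anti (h : IsGauged C κ σ R U A Λ ν b) {r s : ℝ} (hr : 0 < r) (hrs : r ≤ s) :
    (s * u s)⁻¹ ≤ (r * u r)⁻¹ := by
  have := h.pos hr
  have := h.mono hrs
  have : 0 < s := hr.trans_le hrs
  gcongr

theorem density_pos (h : IsGauged C κ σ R U A Λ ν b) {r : ℝ} (hr : 0 < r) :
    0 < (r * u r)⁻¹ := by
  have := h.pos hr
  positivity

theorem flat_dist_le (h : IsGauged C κ σ R U A Λ ν b) (x y : Flattening b ν σ) :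
    dist x y ≤ ((dist x.val b * u (dist x.val b))⁻¹ + (dist y.val b * u (dist y.val b))⁻¹) *
      dist x.val y.val := by
  rw [← h.toReal_metricDensity, ← h.toReal_metricDensity]
  exact Deformed.dist_le x y

theorem flat_dist_le_single (h : IsGauged C κ σ R U A Λ ν b) {x y : Flattening b ν σ}
    (hxy : dist x.val b ≤ dist y.val b) {M : ℝ} (hM : dist y.val b ≤ M * dist x.val b) :
    dist x y ≤ 2 * (1 + M) / u (dist x.val b) := by
  have hx := dist_pos x
  have hu := h.pos hx
  calc dist x y ≤ _ := h.flat_dist_le x y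
    _ ≤ ((dist x.val b * u (dist x.val b))⁻¹ + (dist x.val b * u (dist x.val b))⁻¹) *
        (dist x.val b + M * dist x.val b) := by
      gcongr
      · exact h.mono hxy
      · have := dist_triangle_right x.val y.val b
        linarith
    _ = _ := by field_simp; ring

/-- Upper bound for the distance in the flattening. -/
theorem flat_dist_le_of_le (h : IsGauged C κ σ R U A Λ ν b) {x y : Flattening b ν σ}
    (hxy : dist x.val b ≤ dist y.val b) :
    dist x y ≤ 4 * (1 + κ * Λ) / u (dist x.val b) := by
  have hκ := h.kappa
  have hΛ := h.two_le
  -- Induction on the number of dyadic scales between x and y, moving x outwards.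
  obtain ⟨n, hn⟩ := pow_unbounded_of_one_lt (dist y.val b / dist x.val b)
    (one_lt_two : (1 : ℝ) < 2)
  rw [div_lt_iff₀ (dist_pos x)] at hn
  induction n generalizing x with
  | zero => simp at hn; linarith
  | succ n ih =>
    have hx := dist_pos x
    have hu := h.pos hx
    rcases le_or_gt (dist y.val b) (κ * Λ * dist x.val b) with hy | hy
    · refine (h.flat_dist_le_single hxy hy).trans ?_
      gcongr
      norm_num
    · have hyR := h.dist_le y.val
      have hlt : Λ * dist x.val b < R := by
        have : Λ * dist x.val b ≤ κ * Λ * dist x.val b := by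
          gcongr; nlinarith
        linarith
      obtain ⟨z, hz1, hz2⟩ := h.annulus _ (by positivity) hlt
      have hzb : z ≠ b := _root_.dist_pos.1 (lt_of_lt_of_le (by positivity) hz1)
      -- The jump to z multiplies the distance from b by at least 2 and the gauge by at least 2. The
      -- remaining cost is thus at most half the claimed bound, and the jump itself uses the other
      -- half.
      set z' : Flattening b ν σ := ⟨z, h.metricDensity_ne_top_iff.2 hzb⟩
      have hxz : 2 * dist x.val b ≤ dist z'.val b := le_trans (by gcongr) hz1
      have h1 : dist z' y ≤ 4 * (1 + κ * Λ) / u (dist z'.val b) := by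
        apply ih
        · change dist z b ≤ _; linarith
        · calc dist y.val b < 2 ^ (n + 1) * dist x.val b := hn
            _ = 2 ^ n * (2 * dist x.val b) := by ring
            _ ≤ _ := by gcongr
      have h2 : dist x z' ≤ 2 * (1 + κ * Λ) / u (dist x.val b) :=
        h.flat_dist_le_single (by linarith) (by rw [mul_assoc]; exact hz2.le)
      have h3 : 2 * u (dist x.val b) ≤ u (dist z'.val b) :=
        (h.reverse _ hx hlt.le).trans (h.mono hz1)
      calc dist x y ≤ dist x z' + dist z' y := dist_triangle _ _ _
        _ ≤ 2 * (1 + κ * Λ) / u (dist x.val b) + 4 * (1 + κ * Λ) / (2 * u (dist x.val b)) := by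
          refine add_le_add h2 (h1.trans ?_)
          gcongr
        _ = _ := by field_simp; ring

/-- Lower bound for the distance in the flattening. -/
theorem le_flat_dist (h : IsGauged C κ σ R U A Λ ν b) (x y : Flattening b ν σ) :
    min (dist x.val y.val) (dist x.val b) * (2 * dist x.val b * u (2 * dist x.val b))⁻¹ ≤
      dist x y := by
  have hx := dist_pos x
  set r := dist x.val b
  set g := (2 * r * u (2 * r))⁻¹
  have hg : 0 < g := h.density_pos (by positivity)
  -- The test function is the distance to x truncated at `r`, times the density `g` at radius `2 *
  -- r`. It is constant where `dist z b ≥ 2 * r`; a step with an endpoint nearer to b has density at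
  -- least `g` there.
  have key := Deformed.le_dist (w := metricDensity b ν 0 σ)
    (fun z => min (dist x.val z) r * g) ?_ ?_ x y
  · rw [dist_self, min_eq_left hx.le, zero_mul, Real.dist_eq, zero_sub, abs_neg,
      abs_of_nonneg (by positivity)] at key
    exact key
  · intro a c hac
    rw [eq_of_dist_eq_zero hac, dist_self]
  · intro a c ha hc
    have ha' := _root_.dist_pos.2 (h.metricDensity_ne_top_iff.1 ha)
    have hc' := _root_.dist_pos.2 (h.metricDensity_ne_top_iff.1 hc)
    rw [h.toReal_metricDensity, h.toReal_metricDensity, Real.dist_eq, ← sub_mul, abs_mul,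
      abs_of_pos hg]
    have hpa := h.density_pos ha'
    have hpc := h.density_pos hc'
    by_cases hout : 2 * r ≤ dist a b ∧ 2 * r ≤ dist c b
    · have h1 := dist_triangle_left a b x.val
      have h2 := dist_triangle_left c b x.val
      rw [min_eq_right (by linarith), min_eq_right (by linarith), sub_self, abs_zero, zero_mul]
      positivity
    · have hg' : g ≤ (dist a b * u (dist a b))⁻¹ + (dist c b * u (dist c b))⁻¹ := by
        by_cases h1 : 2 * r ≤ dist a b
        · have h2 : dist c b ≤ 2 * r := by
            by_contra! h2; exact hout ⟨h1, h2.le⟩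
          linarith [h.density_anti hc' h2]
        · linarith [h.density_anti ha' (not_le.1 h1).le]
      have h1 : |min (dist x.val a) r - min (dist x.val c) r| ≤ dist a c :=
        (abs_min_sub_min_le_max _ _ _ _).trans (by
          simpa [dist_comm] using abs_dist_sub_le a c x.val)
      rw [mul_comm]
      gcongr

end IsGauged

theorem Deformed.measurableEmbedding_val {X : Type*} [MeasurableSpace X] {w : X → ℝ≥0∞}
    (hw : MeasurableSet {x | w x ≠ ∞}) : MeasurableEmbedding (Deformed.val : Deformed w → X) where
  injective := by rintro ⟨x, hx⟩ ⟨y, hy⟩ rfl; rfl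
  measurable := comap_measurable _
  measurableSet_image' := by
    rintro _ ⟨t, ht, rfl⟩
    have : Deformed.val '' (Deformed.val ⁻¹' t : Set (Deformed w)) = t ∩ {x | w x ≠ ∞} := by
      ext x
      constructor
      · rintro ⟨y, hy, rfl⟩; exact ⟨hy, y.ne_top⟩
      · rintro ⟨hx, hx'⟩; exact ⟨⟨x, hx'⟩, hx, rfl⟩
    rw [this]
    exact ht.inter hw

theorem deformedMeasure_apply {X : Type*} [MeasurableSpace X] {w : X → ℝ≥0∞}
    (hw : MeasurableSet {x | w x ≠ ∞}) (μ : Measure X) (σ : ℝ) (s : Set (Deformed w)) :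
    deformedMeasure w μ σ s = (μ.withDensity fun x => w x ^ σ) (Deformed.val '' s) :=
  (Deformed.measurableEmbedding_val hw).comap_apply _ _

/-! ### Balls around `bhat` and measures of regions in the flattening -/

namespace IsGauged

variable {Z : Type*} [MetricSpace Z] [MeasurableSpace Z] {C κ σ R U A Λ : ℝ} {ν : Measure Z} {b : Z}

local notation "u" => ballGauge b ν σ

theorem U_le (h : IsGauged C κ σ R U A Λ ν b) {r : ℝ} (hr : 0 < r) {n : ℕ} (hn : R < 2 ^ n * r) :
    U ≤ A ^ n * u r := by
  rw [← h.top _ hn]; exact h.le_two_pow hr le_rfl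

/-- Beyond `bhat` the gauge is comparable to its maximum U, so the bound at `bhat` serves there; the
summand 1 is absorbed by `U / u ≥ 1`. -/
theorem dist_add_one_le (h : IsGauged C κ σ R U A Λ ν b) {bhat : Flattening b ν σ} {n : ℕ}
    (hn : R < 2 ^ n * dist bhat.val b) (x : Flattening b ν σ) :
    dist x bhat + 1 ≤ (4 * (1 + κ * Λ) * A ^ n + U) / u (dist x.val b) := by
  have hx := dist_pos x
  have hu := h.pos hx
  have hκ := h.kappa
  have hΛ := h.two_le
  have hA := h.one_le_A
  have hAn : 1 ≤ A ^ n := one_le_pow₀ hA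
  have h1 : 1 ≤ U / u (dist x.val b) := by
    rw [one_le_div hu]; exact h.le_top _
  rw [add_div]
  refine add_le_add ?_ h1
  rcases le_total (dist x.val b) (dist bhat.val b) with hxb | hxb
  · refine (h.flat_dist_le_of_le hxb).trans ?_
    have : 4 * (1 + κ * Λ) ≤ 4 * (1 + κ * Λ) * A ^ n :=
      le_mul_of_one_le_right (by positivity) hAn
    gcongr
  · rw [dist_comm]
    refine (h.flat_dist_le_of_le hxb).trans ?_
    have hub := h.pos (dist_pos bhat)
    rw [div_le_div_iff₀ hub hu, mul_assoc (4 * (1 + κ * Λ))]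
    gcongr
    exact (h.le_top _).trans (h.U_le (dist_pos bhat) hn)

/-- If x is close to b, then `bhat` is at distance at least `dist x b` from x and `le_flat_dist`
applies. Otherwise `1 / u` is bounded and the summand 1 dominates it. -/
theorem inv_le_dist_add_one (h : IsGauged C κ σ R U A Λ ν b) {bhat : Flattening b ν σ} {n : ℕ}
    (hn : R < 2 ^ n * dist bhat.val b) (x : Flattening b ν σ) :
    (u (dist x.val b))⁻¹ ≤ (2 * A + A ^ (n + 1) / U) * (dist x bhat + 1) := by
  have hx := dist_pos x
  have hu := h.pos hx
  have hA := h.one_le_A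
  have hU := h.U_pos
  have hd : 0 ≤ dist x bhat := dist_nonneg
  rw [add_mul]
  rcases le_or_gt (2 * dist x.val b) (dist bhat.val b) with hxb | hxb
  · have h1 := h.le_flat_dist x bhat
    have h2 := dist_triangle_left bhat.val b x.val
    rw [min_eq_right (by linarith)] at h1
    have h3 : u (2 * dist x.val b) ≤ A * u (dist x.val b) := by
      simpa using h.le_two_pow hx (n := 1) (by simp)
    have hu2 := h.pos (r := 2 * dist x.val b) (by positivity)
    have h4 : (u (dist x.val b))⁻¹ ≤ 2 * A * dist x bhat := by
      calc (u (dist x.val b))⁻¹ = 2 * A * (2 * (A * u (dist x.val b)))⁻¹ := by field_simp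
        _ ≤ 2 * A * (2 * u (2 * dist x.val b))⁻¹ := by gcongr
        _ = 2 * A * (dist x.val b * (2 * dist x.val b * u (2 * dist x.val b))⁻¹) := by
          field_simp
        _ ≤ _ := by gcongr
    have : 0 ≤ A ^ (n + 1) / U * (dist x bhat + 1) := by positivity
    have : 0 ≤ 2 * A := by positivity
    linarith
  · have h1 : U ≤ A ^ (n + 1) * u (dist x.val b) := h.U_le hx (by
      calc R < 2 ^ n * dist bhat.val b := hn
        _ ≤ 2 ^ n * (2 * dist x.val b) := by gcongr
        _ = _ := by ring)
    have h2 : (u (dist x.val b))⁻¹ ≤ A ^ (n + 1) / U := by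
      rw [inv_eq_one_div, div_le_div_iff₀ hu hU]; linarith
    have h3 : A ^ (n + 1) / U ≤ A ^ (n + 1) / U * (dist x bhat + 1) :=
      le_mul_of_one_le_right (by positivity) (by linarith)
    have : 0 ≤ 2 * A * (dist x bhat + 1) := by positivity
    linarith

/-- Comparison of the radius `dist x bhat + 1` with the gauge. -/
structure IsComparable (bhat : Flattening b ν σ) (M L : ℝ) :
    Prop where
  le : ∀ x : Flattening b ν σ, dist x bhat + 1 ≤ M / u (dist x.val b)
  ge : ∀ x : Flattening b ν σ, (u (dist x.val b))⁻¹ ≤ L * (dist x bhat + 1)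

/-- A point much closer to b than x would have a gauge smaller by the factor `2 ^ N`, hence would be
too far from `bhat` in the flattened distance. -/
theorem le_dist_of_mem_ball (h : IsGauged C κ σ R U A Λ ν b) {bhat : Flattening b ν σ} {M L : ℝ}
    (hc : IsComparable bhat M L) {N : ℕ} (hN : 2 * L * M < 2 ^ N)
    {x y : Flattening b ν σ} (hy : y ∈ ball bhat (dist x bhat + 1)) :
    dist x.val b ≤ Λ ^ N * dist y.val b := by
  by_contra! hlt
  have hux := h.pos (dist_pos x)
  have huy := h.pos (dist_pos y)
  have h1 := h.reverse_pow (dist_pos y) N (hlt.le.trans (h.dist_le _))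
  have h2 := h.mono (σ := σ) hlt.le
  have h3 := hc.ge y
  have hd : 0 ≤ dist x bhat := dist_nonneg
  have hL : 0 < L := by
    by_contra! hL
    have : 0 < (u (dist y.val b))⁻¹ := by positivity
    have : L * (dist y bhat + 1) ≤ 0 := mul_nonpos_of_nonpos_of_nonneg hL (by positivity)
    linarith
  have h4 : (u (dist y.val b))⁻¹ ≤ 2 * L * M / u (dist x.val b) := by
    calc (u (dist y.val b))⁻¹ ≤ L * (dist y bhat + 1) := h3
      _ ≤ L * (2 * (M / u (dist x.val b))) := by
        have := hc.le x
        have := mem_ball.1 hy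
        gcongr
        linarith
      _ = _ := by ring
  rw [inv_eq_one_div, div_le_div_iff₀ huy hux] at h4
  have h5 : 2 * L * M * u (dist y.val b) < 2 ^ N * u (dist y.val b) := by gcongr
  linarith

/-- If y and `bhat` are both much further from b than x, their flattened distance is at most a
constant over `2 ^ N * u`, which is small compared with the radius. -/
theorem mem_ball_of_le_dist (h : IsGauged C κ σ R U A Λ ν b) {bhat : Flattening b ν σ} {M L : ℝ}
    (hc : IsComparable bhat M L) {N : ℕ} (hN : L * (4 * (1 + κ * Λ)) < 2 ^ N)
    {x y : Flattening b ν σ} (hx : Λ ^ N * dist x.val b ≤ dist bhat.val b)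
    (hy : Λ ^ N * dist x.val b ≤ dist y.val b) : y ∈ ball bhat (dist x bhat + 1) := by
  have hux := h.pos (dist_pos x)
  have hκ := h.kappa
  have hΛ := h.two_le
  have h1 := h.reverse_pow (dist_pos x) N (hx.trans (h.dist_le _))
  have h3 := hc.ge x
  have hd : 0 ≤ dist x bhat := dist_nonneg
  have h4 : dist y bhat ≤ 4 * (1 + κ * Λ) / (2 ^ N * u (dist x.val b)) := by
    rcases le_total (dist y.val b) (dist bhat.val b) with hyb | hyb
    · refine (h.flat_dist_le_of_le hyb).trans ?_
      gcongr
      exact h1.trans (h.mono hy)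
    · rw [dist_comm]
      refine (h.flat_dist_le_of_le hyb).trans ?_
      gcongr
      exact h1.trans (h.mono hx)
  rw [mem_ball]
  by_contra! hlt
  have h5 : 2 ^ N * (dist x bhat + 1) ≤ L * (4 * (1 + κ * Λ)) * (dist x bhat + 1) := by
    calc 2 ^ N * (dist x bhat + 1)
        ≤ 2 ^ N * (4 * (1 + κ * Λ) / (2 ^ N * u (dist x.val b))) := by
          gcongr; exact hlt.trans h4
      _ = 4 * (1 + κ * Λ) * (u (dist x.val b))⁻¹ := by field_simp
      _ ≤ 4 * (1 + κ * Λ) * (L * (dist x bhat + 1)) := by gcongr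
      _ = _ := by ring
  have := le_of_mul_le_mul_right h5 (by positivity)
  linarith

theorem density_rpow (h : IsGauged C κ σ R U A Λ ν b) {x : Z} (hx : x ≠ b) :
    metricDensity b ν 0 σ x ^ σ =
      ENNReal.ofReal (dist x b ^ σ * ν.real (ball b (dist x b)))⁻¹ := by
  have h0 := _root_.dist_pos.2 hx
  rw [h.metricDensity_eq hx, ENNReal.ofReal_rpow_of_pos (h.density_pos h0),
    Real.inv_rpow (mul_nonneg h0.le (h.pos h0).le), Real.mul_rpow h0.le (h.pos h0).le,
    h.rpow_eq]

variable [BorelSpace Z]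

theorem measurable_density (h : IsGauged C κ σ R U A Λ ν b) :
    Measurable (metricDensity b ν 0 σ) :=
  measurable_metricDensity_zero b ν h.sigma_pos

theorem measurableSet_density_ne_top (h : IsGauged C κ σ R U A Λ ν b) :
    MeasurableSet {x | metricDensity b ν 0 σ x ≠ ∞} :=
  h.measurable_density (measurableSet_singleton ∞).compl

theorem withDensity_annulus_le (h : IsGauged C κ σ R U A Λ ν b) {r : ℝ} (hr : 0 < r) :
    (ν.withDensity fun x => metricDensity b ν 0 σ x ^ σ) {z | r ≤ dist z b ∧ dist z b < 2 * r} ≤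
      ENNReal.ofReal (C * r ^ (-σ)) := by
  have hm : MeasurableSet {z | r ≤ dist z b ∧ dist z b < 2 * r} :=
    (measurableSet_le measurable_const (by fun_prop : Continuous fun z => dist z b).measurable).inter
    (measurableSet_lt (by fun_prop : Continuous fun z => dist z b).measurable measurable_const)
  have hv := h.doubling.real_ball_pos b hr
  rw [withDensity_apply _ hm]
  calc ∫⁻ z in {z | r ≤ dist z b ∧ dist z b < 2 * r}, metricDensity b ν 0 σ z ^ σ ∂ν
      ≤ ∫⁻ z in {z | r ≤ dist z b ∧ dist z b < 2 * r},
          ENNReal.ofReal (r ^ σ * ν.real (ball b r))⁻¹ ∂ν := by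
        refine setLIntegral_mono' hm fun z hz => ?_
        rw [h.density_rpow (_root_.dist_pos.1 (hr.trans_le hz.1))]
        have := h.doubling.real_ball_mono (ball_subset_ball (x := b) hz.1)
        have := hz.1
        have := h.sigma_pos
        gcongr
    _ = ENNReal.ofReal (r ^ σ * ν.real (ball b r))⁻¹ *
          ν {z | r ≤ dist z b ∧ dist z b < 2 * r} := setLIntegral_const _ _
    _ ≤ ENNReal.ofReal (r ^ σ * ν.real (ball b r))⁻¹ *
          (ENNReal.ofReal C * ν (ball b r)) := by
        gcongr
        exact (measure_mono fun z hz => mem_ball.2 hz.2).trans (h.doubling.2 b r hr).2.1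
    _ = _ := by
        rw [← ofReal_measureReal (h.doubling.ball_ne_top b r),
          ← ENNReal.ofReal_mul (by linarith [h.doubling.1]), ← ENNReal.ofReal_mul (by positivity),
          Real.rpow_neg hr.le]
        congr 1
        field_simp

/-- The dyadic annulus at radius `2 ^ k * r` has measure at most `C * (2 ^ k * r) ^ (-σ)`, because
the ball measure in the density cancels by doubling. These bounds sum geometrically. -/
theorem flatteningMeasure_far_le (h : IsGauged C κ σ R U A Λ ν b) {r : ℝ} (hr : 0 < r) :
    flatteningMeasure b ν σ {x | r ≤ dist x.val b} ≤
      ENNReal.ofReal (C / (1 - 2 ^ (-σ)) * r ^ (-σ)) := by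
  have hσ := h.sigma_pos
  have hC : 0 < C := by linarith [h.doubling.1]
  have hq0 : (0 : ℝ) ≤ 2 ^ (-σ) := by positivity
  have hq1 : (2 : ℝ) ^ (-σ) < 1 := Real.rpow_lt_one_of_one_lt_of_neg (by norm_num) (by linarith)
  rw [deformedMeasure_apply h.measurableSet_density_ne_top]
  calc _ ≤ (ν.withDensity fun x => metricDensity b ν 0 σ x ^ σ)
        (⋃ k : ℕ, {z | 2 ^ k * r ≤ dist z b ∧ dist z b < 2 * (2 ^ k * r)}) := by
        refine measure_mono ?_
        rintro _ ⟨x, hx, rfl⟩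
        obtain ⟨k, hk1, hk2⟩ := exists_nat_pow_near (x := dist x.val b / r) (y := 2)
          ((one_le_div hr).2 hx) (by norm_num)
        rw [le_div_iff₀ hr] at hk1
        rw [div_lt_iff₀ hr] at hk2
        exact mem_iUnion.2 ⟨k, hk1, hk2.trans_eq (by ring)⟩
    _ ≤ ∑' k : ℕ, ENNReal.ofReal (C * (2 ^ k * r) ^ (-σ)) :=
        (measure_iUnion_le _).trans
          (ENNReal.tsum_le_tsum fun k => h.withDensity_annulus_le (by positivity))
    _ = ∑' k : ℕ, ENNReal.ofReal (C * r ^ (-σ) * ((2 : ℝ) ^ (-σ)) ^ k) := by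
        congr 1
        ext k
        rw [Real.mul_rpow (by positivity) hr.le, ← Real.rpow_natCast, ← Real.rpow_natCast,
          ← Real.rpow_mul (by norm_num), ← Real.rpow_mul (by norm_num), mul_comm (k : ℝ)]
        ring_nf
    _ = ENNReal.ofReal (C * r ^ (-σ) * (1 - 2 ^ (-σ))⁻¹) := by
        rw [← ENNReal.ofReal_tsum_of_nonneg (fun k => by positivity)
          ((summable_geometric_of_lt_one hq0 hq1).mul_left _), tsum_mul_left,
          tsum_geometric_of_lt_one hq0 hq1]
    _ = _ := by congr 1; ring

/-- On a ball around z that avoids b and lies within distance s of b, the density is at least its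
value at radius s. Doubling from `ball z r` to a ball containing `ball b s` cancels the measure
factor at the cost of `C ^ j = (A ^ j) ^ σ`. -/
theorem le_flatteningMeasure (h : IsGauged C κ σ R U A Λ ν b) {z : Z} {r s t : ℝ} {j : ℕ}
    (hr : 0 < r) (hs : 0 < s) (hrz : r ≤ dist z b) (hball : ∀ y ∈ ball z r, dist y b ≤ s)
    (hst : dist b z + s ≤ t) (ht : t ≤ 2 ^ j * r)
    {S : Set (Flattening b ν σ)} (hS : ∀ y : Flattening b ν σ, y.val ∈ ball z r → y ∈ S) :
    ENNReal.ofReal ((A ^ j * s) ^ (-σ)) ≤ flatteningMeasure b ν σ S := by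
  have hσ := h.sigma_pos
  have hA := h.one_le_A
  have hC : 0 < C := by linarith [h.doubling.1]
  have hvs := h.doubling.real_ball_pos b hs
  have hne : ∀ y ∈ ball z r, y ≠ b := by
    rintro _ hy rfl
    rw [mem_ball'] at hy
    linarith
  have hv : ν.real (ball b s) ≤ C ^ j * ν.real (ball z r) :=
    (h.doubling.real_ball_mono (ball_subset_ball' (by linarith))).trans
      (h.doubling.real_ball_le z hr ht)
  have hAj : (A ^ j) ^ σ = C ^ j := by
    rw [h.A_eq, ← Real.rpow_natCast, ← Real.rpow_mul hC.le, ← Real.rpow_mul hC.le,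
      one_div, mul_comm, ← mul_assoc, mul_inv_cancel₀ hσ.ne', one_mul, Real.rpow_natCast]
  rw [deformedMeasure_apply h.measurableSet_density_ne_top]
  calc ENNReal.ofReal ((A ^ j * s) ^ (-σ))
      ≤ ENNReal.ofReal ((s ^ σ * ν.real (ball b s))⁻¹ * ν.real (ball z r)) := by
        refine ENNReal.ofReal_le_ofReal ?_
        rw [Real.rpow_neg (by positivity), Real.mul_rpow (by positivity) hs.le, hAj,
          inv_mul_eq_div, inv_eq_one_div, div_le_div_iff₀ (by positivity) (by positivity), one_mul]
        calc s ^ σ * ν.real (ball b s) ≤ s ^ σ * (C ^ j * ν.real (ball z r)) := by gcongr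
          _ = _ := by ring
    _ = ENNReal.ofReal (s ^ σ * ν.real (ball b s))⁻¹ * ν (ball z r) := by
        rw [ENNReal.ofReal_mul (by positivity), ofReal_measureReal (h.doubling.ball_ne_top z r)]
    _ = ∫⁻ y in ball z r, ENNReal.ofReal (s ^ σ * ν.real (ball b s))⁻¹ ∂ν :=
        (setLIntegral_const _ _).symm
    _ ≤ ∫⁻ y in ball z r, metricDensity b ν 0 σ y ^ σ ∂ν := by
        refine setLIntegral_mono' measurableSet_ball fun y hy => ?_
        rw [h.density_rpow (hne y hy)]
        have h0 := _root_.dist_pos.2 (hne y hy)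
        have h1 := h.doubling.real_ball_pos b h0
        have h2 := hball y hy
        have := h.doubling.real_ball_mono (ball_subset_ball (x := b) h2)
        gcongr
    _ = (ν.withDensity fun x => metricDensity b ν 0 σ x ^ σ) (ball z r) :=
        (withDensity_apply _ measurableSet_ball).symm
    _ ≤ _ := by
        refine measure_mono fun y hy => ?_
        exact ⟨⟨y, h.metricDensity_ne_top_iff.2 (hne y hy)⟩, hS _ hy, rfl⟩

end IsGauged

/-! ### The second density is comparable to the reciprocal of the first -/

namespace IsGauged

variable {Z : Type*} [MetricSpace Z] [MeasurableSpace Z] [BorelSpace Z]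
  {C κ σ R U A Λ : ℝ} {ν : Measure Z} {b : Z}

local notation "u" => ballGauge b ν σ

theorem flatteningMeasure_ball_le (h : IsGauged C κ σ R U A Λ ν b) {bhat : Flattening b ν σ}
    {M L : ℝ} (hc : IsComparable bhat M L) {N : ℕ} (hN : 2 * L * M < 2 ^ N)
    (x : Flattening b ν σ) :
    flatteningMeasure b ν σ (ball bhat (dist x bhat + 1)) ≤
      ENNReal.ofReal (C / (1 - 2 ^ (-σ)) * (dist x.val b / Λ ^ N) ^ (-σ)) := by
  have hΛ := h.two_le
  have hx := dist_pos x
  refine (measure_mono fun y hy => ?_).trans (h.flatteningMeasure_far_le (by positivity))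
  rw [mem_ofPred_eq, div_le_iff₀ (by positivity), mul_comm]
  exact h.le_dist_of_mem_ball hc hN hy

theorem ballGauge_flattening_le (h : IsGauged C κ σ R U A Λ ν b) {bhat : Flattening b ν σ}
    {M L : ℝ} (hc : IsComparable bhat M L) {N : ℕ} (hN : 2 * L * M < 2 ^ N)
    (x : Flattening b ν σ) :
    ballGauge bhat (flatteningMeasure b ν σ) σ (dist x bhat + 1) ≤
      (C / (1 - 2 ^ (-σ))) ^ (1 / σ) * Λ ^ N / dist x.val b := by
  have hΛ := h.two_le
  have hx := dist_pos x
  have hσ := h.sigma_pos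
  have hC : 0 < C := by linarith [h.doubling.1]
  have hq1 : (2 : ℝ) ^ (-σ) < 1 := Real.rpow_lt_one_of_one_lt_of_neg (by norm_num) (by linarith)
  have hE : 0 < C / (1 - 2 ^ (-σ)) := div_pos hC (by linarith)
  have h1 : (flatteningMeasure b ν σ).real (ball bhat (dist x bhat + 1)) ≤
      C / (1 - 2 ^ (-σ)) * (dist x.val b / Λ ^ N) ^ (-σ) :=
    ENNReal.toReal_le_of_le_ofReal (by positivity) (h.flatteningMeasure_ball_le hc hN x)
  calc ballGauge bhat (flatteningMeasure b ν σ) σ (dist x bhat + 1)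
      ≤ (C / (1 - 2 ^ (-σ)) * (dist x.val b / Λ ^ N) ^ (-σ)) ^ (1 / σ) :=
        Real.rpow_le_rpow measureReal_nonneg h1 (by positivity)
    _ = _ := by
        rw [Real.mul_rpow hE.le (by positivity), ← Real.rpow_mul (by positivity),
          show -σ * (1 / σ) = -1 by field_simp, Real.rpow_neg_one, inv_div, mul_div_assoc]

/-- An annulus at scale `2 * Λ ^ N * dist x b` contains a point z, and a ball around z at that scale
stays far enough from b to lie in the flattened ball. -/
theorem le_flatteningMeasure_ball_of_near (h : IsGauged C κ σ R U A Λ ν b)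
    {bhat : Flattening b ν σ} {M L : ℝ} (hc : IsComparable bhat M L) {N : ℕ}
    (hN : L * (4 * (1 + κ * Λ)) < 2 ^ N) {j : ℕ} (hj : 5 * κ ≤ 2 ^ j) (x : Flattening b ν σ)
    (hx : 2 * (Λ ^ N * dist x.val b) < dist bhat.val b) :
    ENNReal.ofReal ((A ^ j * (3 * κ * (Λ ^ N * dist x.val b))) ^ (-σ)) ≤
      flatteningMeasure b ν σ (ball bhat (dist x bhat + 1)) := by
  have hΛ := h.two_le
  have hκ := h.kappa
  have hx0 := dist_pos x
  set s := Λ ^ N * dist x.val b with hs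
  have hs0 : 0 < s := by positivity
  obtain ⟨z, hz1, hz2⟩ := h.annulus (2 * s) (by positivity) (hx.trans_le (h.dist_le _))
  refine h.le_flatteningMeasure (z := z) (r := s) (t := 5 * κ * s) hs0 (by positivity)
    (by linarith) (fun y hy => ?_) ?_ (by gcongr) (fun y hy => ?_)
  · have := dist_triangle y z b
    have := mem_ball.1 hy
    nlinarith
  · rw [dist_comm]; linarith
  · refine h.mem_ball_of_le_dist hc hN (by rw [← hs]; linarith) ?_
    have := dist_triangle_left z b y.val
    have := mem_ball.1 hy
    rw [← hs]
    linarith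

/-- For x away from b the unit ball already has enough mass: by the bound `hr2`, it contains the
original ball of radius r around `bhat`. -/
theorem le_flatteningMeasure_ball_one (h : IsGauged C κ σ R U A Λ ν b)
    {bhat : Flattening b ν σ} {n : ℕ} (hn : R < 2 ^ n * dist bhat.val b) {r : ℝ} (hr : 0 < r)
    (hr1 : 2 * r ≤ dist bhat.val b) (hr2 : 4 * A ^ (n + 1) * r ≤ dist bhat.val b * U)
    {j : ℕ} (hj : 2 * R ≤ 2 ^ j * r) :
    ENNReal.ofReal ((A ^ j * R) ^ (-σ)) ≤ flatteningMeasure b ν σ (ball bhat 1) := by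
  have hb := dist_pos bhat
  set β := dist bhat.val b
  have hA := h.one_le_A
  have hU := h.U_pos
  refine h.le_flatteningMeasure (z := bhat.val) (r := r) (t := 2 * R) hr h.R_pos
    (by change r ≤ β; linarith) (fun y _ => h.dist_le y) ?_ hj (fun y hy => ?_)
  · have := h.dist_le bhat.val
    rw [dist_comm]; linarith
  · have h1 : U ≤ A ^ (n + 1) * u (β / 2) := h.U_le (by positivity) (by rw [pow_succ]; linarith)
    have hyr := mem_ball.1 hy
    have h2 : β / 2 ≤ dist y.val b := by
      have := dist_triangle_left bhat.val b y.val
      have e : β = dist bhat.val b := rfl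
      linarith
    have hu := h.pos (r := β / 2) (by positivity)
    have hg := h.density_pos (r := β / 2) (by positivity)
    have h3 : dist y bhat < 2 * (β / 2 * u (β / 2))⁻¹ * r := by
      refine (h.flat_dist_le y bhat).trans_lt ?_
      have h4 := h.density_anti (by positivity) h2
      have h5 := h.density_anti (r := β / 2) (s := β) (by positivity) (by linarith)
      calc _ ≤ 2 * (β / 2 * u (β / 2))⁻¹ * dist y.val bhat.val := by gcongr; linarith
        _ < _ := by gcongr
    refine mem_ball.2 (h3.trans_le ?_)
    rw [← div_eq_mul_inv, div_mul_eq_mul_div, div_le_one (by positivity)]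
    have h6 : 4 * A ^ (n + 1) * r ≤ 4 * A ^ (n + 1) * (β * u (β / 2) / 4) := by
      calc _ ≤ β * U := hr2
        _ ≤ β * (A ^ (n + 1) * u (β / 2)) := by gcongr
        _ = _ := by ring
    have := le_of_mul_le_mul_left h6 (by positivity)
    linarith

theorem le_flatteningMeasure_ball (h : IsGauged C κ σ R U A Λ ν b)
    {bhat : Flattening b ν σ} {M L : ℝ} (hc : IsComparable bhat M L) {n : ℕ}
    (hn : R < 2 ^ n * dist bhat.val b) {N : ℕ} (hN : L * (4 * (1 + κ * Λ)) < 2 ^ N)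
    {r : ℝ} (hr : 0 < r)
    (hr1 : 2 * r ≤ dist bhat.val b) (hr2 : 4 * A ^ (n + 1) * r ≤ dist bhat.val b * U)
    {j : ℕ} (hj : 5 * κ ≤ 2 ^ j) (hj2 : 2 * R ≤ 2 ^ j * r) (x : Flattening b ν σ) :
    ENNReal.ofReal ((A ^ j * (3 * κ + 2 * R / dist bhat.val b) * Λ ^ N * dist x.val b) ^ (-σ)) ≤
      flatteningMeasure b ν σ (ball bhat (dist x bhat + 1)) := by
  have hb := dist_pos bhat
  have hx := dist_pos x
  have hΛ := h.two_le
  have hκ := h.kappa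
  have hA := h.one_le_A
  have hσ := h.sigma_pos
  have hR := h.R_pos
  -- The summand `3 * κ` of the constant serves the first case. In the second, `Λ ^ N * dist x b` is
  -- at least half of `dist bhat b`, so R is at most `2 * R / dist bhat b` times it.
  rcases lt_or_ge (2 * (Λ ^ N * dist x.val b)) (dist bhat.val b) with hxb | hxb
  · refine le_trans (ENNReal.ofReal_le_ofReal ?_)
      (h.le_flatteningMeasure_ball_of_near hc hN hj x hxb)
    refine Real.rpow_le_rpow_of_nonpos (by positivity) ?_ (by linarith)
    have : 0 ≤ A ^ j * (2 * R / dist bhat.val b) * Λ ^ N * dist x.val b := by positivity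
    calc _ ≤ A ^ j * (3 * κ * (Λ ^ N * dist x.val b)) +
          A ^ j * (2 * R / dist bhat.val b) * Λ ^ N * dist x.val b := by linarith
      _ = _ := by ring
  · have hd : 0 ≤ dist x bhat := dist_nonneg
    refine le_trans (ENNReal.ofReal_le_ofReal ?_)
      ((h.le_flatteningMeasure_ball_one hn hr hr1 hr2 hj2).trans
        (measure_mono (ball_subset_ball (by linarith))))
    refine Real.rpow_le_rpow_of_nonpos (by positivity) ?_ (by linarith)
    have h1 : R ≤ R / dist bhat.val b * (2 * (Λ ^ N * dist x.val b)) := by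
      rw [div_mul_eq_mul_div, le_div_iff₀ hb]
      gcongr
    calc A ^ j * R ≤ A ^ j * (R / dist bhat.val b * (2 * (Λ ^ N * dist x.val b))) := by gcongr
      _ ≤ A ^ j * (R / dist bhat.val b * (2 * (Λ ^ N * dist x.val b))) +
          A ^ j * (3 * κ) * Λ ^ N * dist x.val b := le_add_of_nonneg_right (by positivity)
      _ = _ := by ring

/-- The density of the sphericalization is comparable to the reciprocal of that of the
flattening. -/
structure IsBalanced (bhat : Flattening b ν σ) (B : ℝ) (q : Flattening b ν σ → ℝ) : Prop where
  pos : 0 < B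
  q_pos : ∀ x, 0 < q x
  density_eq : ∀ x, metricDensity bhat (flatteningMeasure b ν σ) 1 σ x = ENNReal.ofReal (q x)
  le : ∀ x : Flattening b ν σ, q x ≤ B * (dist x.val b * u (dist x.val b))
  ge : ∀ x : Flattening b ν σ, dist x.val b * u (dist x.val b) ≤ B * q x

omit [BorelSpace Z] in
-- Radius `≈ 1 / u` times measure root `≈ 1 / dist x b` gives the reciprocal of the second density.
-- Of the constant, `L * D` gives the upper bound and `M * E` the lower.
theorem isBalanced (h : IsGauged C κ σ R U A Λ ν b) {bhat : Flattening b ν σ} {M L D E : ℝ}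
    (hc : IsComparable bhat M L)
    (hD : ∀ x : Flattening b ν σ, ENNReal.ofReal ((D * dist x.val b) ^ (-σ)) ≤
      flatteningMeasure b ν σ (ball bhat (dist x bhat + 1)))
    (hD0 : 0 < D)
    (hfin : ∀ x : Flattening b ν σ, flatteningMeasure b ν σ (ball bhat (dist x bhat + 1)) ≠ ∞)
    (hE : ∀ x : Flattening b ν σ,
      ballGauge bhat (flatteningMeasure b ν σ) σ (dist x bhat + 1) ≤ E / dist x.val b) :
    IsBalanced bhat (L * D + M * E) fun x =>
      ((dist x bhat + 1) * ballGauge bhat (flatteningMeasure b ν σ) σ (dist x bhat + 1))⁻¹ := by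
  have hσ := h.sigma_pos
  have hm : ∀ x, 0 < dist x bhat + 1 := fun x => by positivity
  have hg : ∀ x : Flattening b ν σ, (D * dist x.val b)⁻¹ ≤
      ballGauge bhat (flatteningMeasure b ν σ) σ (dist x bhat + 1) := by
    intro x
    have hx := dist_pos x
    calc (D * dist x.val b)⁻¹ = ((D * dist x.val b) ^ (-σ)) ^ (1 / σ) := by
          rw [← Real.rpow_mul (by positivity), show -σ * (1 / σ) = -1 by field_simp,
            Real.rpow_neg_one]
      _ ≤ _ := Real.rpow_le_rpow (by positivity)
          ((ENNReal.ofReal_le_iff_le_toReal (hfin x)).1 (hD x)) (by positivity)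
  have hg0 : ∀ x : Flattening b ν σ,
      0 < ballGauge bhat (flatteningMeasure b ν σ) σ (dist x bhat + 1) := fun x =>
    lt_of_lt_of_le (by have := dist_pos x; positivity) (hg x)
  have hL : 0 < L := by
    by_contra! hL
    have h1 := hc.ge bhat
    have h2 := inv_pos.2 (h.pos (dist_pos bhat))
    have := mul_nonpos_of_nonpos_of_nonneg hL (hm bhat).le
    linarith
  have hM : 0 < M := by
    have h1 := (hm bhat).trans_le (hc.le bhat)
    exact (div_pos_iff_of_pos_right (h.pos (dist_pos bhat))).1 h1
  have hE0 : 0 < E := by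
    have h1 := (hg0 bhat).trans_le (hE bhat)
    exact (div_pos_iff_of_pos_right (dist_pos bhat)).1 h1
  refine ⟨by positivity, fun x => inv_pos.2 (mul_pos (hm x) (hg0 x)), fun x => ?_, fun x => ?_,
    fun x => ?_⟩
  · refine metricDensity_eq_ofReal σ (hm x) (fun h0 => ?_) (hfin x)
    have := hD x
    rw [h0] at this
    have hx := dist_pos x
    exact absurd this (not_le.2 (by simpa using by positivity))
  · have hx := dist_pos x
    have hu := h.pos hx
    have h1 := hc.ge x
    have h2 := hg x
    rw [inv_le_comm₀ (mul_pos (hm x) (hg0 x)) (by positivity)]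
    have h3 : (u (dist x.val b))⁻¹ / L ≤ dist x bhat + 1 := by
      rw [div_le_iff₀ hL]; linarith
    calc ((L * D + M * E) * (dist x.val b * u (dist x.val b)))⁻¹
        ≤ (L * D * (dist x.val b * u (dist x.val b)))⁻¹ := by
          gcongr
          exact le_add_of_nonneg_right (by positivity)
      _ = (u (dist x.val b))⁻¹ / L * (D * dist x.val b)⁻¹ := by field_simp
      _ ≤ _ := by gcongr
  · have hx := dist_pos x
    have hu := h.pos hx
    have h1 := hc.le x
    have h2 := hE x
    have h0 := hg0 x
    have h0' := hm x
    rw [← div_eq_mul_inv, le_div_iff₀ (mul_pos (hm x) (hg0 x))]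
    calc _ ≤ dist x.val b * u (dist x.val b) * (M / u (dist x.val b) * (E / dist x.val b)) := by
          gcongr
      _ = M * E := by field_simp
      _ ≤ _ := le_add_of_nonneg_left (by positivity)

theorem exists_isBalanced (C κ σ R U A Λ β : ℝ) :
    ∃ B : ℝ, ∀ {Z : Type*} [MetricSpace Z] [MeasurableSpace Z] [BorelSpace Z]
      {ν : Measure Z} {b : Z}, IsGauged C κ σ R U A Λ ν b →
      ∀ bhat : Flattening b ν σ, dist bhat.val b = β → ∃ q, IsBalanced bhat B q := by
  -- The constants are chosen before the space, when β is not yet known to be positive.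
  obtain ⟨n, hn⟩ : ∃ n : ℕ, 0 < β → R < 2 ^ n * β := by
    obtain ⟨n, hn⟩ := pow_unbounded_of_one_lt (R / β) (one_lt_two : (1 : ℝ) < 2)
    exact ⟨n, fun hβ => by rwa [div_lt_iff₀ hβ] at hn⟩
  set M := 4 * (1 + κ * Λ) * A ^ n + U
  set L := 2 * A + A ^ (n + 1) / U
  obtain ⟨N₁, hN₁⟩ := pow_unbounded_of_one_lt (2 * L * M) (one_lt_two : (1 : ℝ) < 2)
  obtain ⟨N₂, hN₂⟩ := pow_unbounded_of_one_lt (L * (4 * (1 + κ * Λ))) (one_lt_two : (1 : ℝ) < 2)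
  -- The first bound keeps the ball around `bhat` at distance `β / 2` from b, the second puts it
  -- into the flattened unit ball.
  set r := min (β / 2) (β * U / (4 * A ^ (n + 1)))
  obtain ⟨j, hj⟩ := pow_unbounded_of_one_lt (max (5 * κ) (2 * R / r)) (one_lt_two : (1 : ℝ) < 2)
  refine ⟨L * (A ^ j * (3 * κ + 2 * R / β) * Λ ^ N₂) +
    M * ((C / (1 - 2 ^ (-σ))) ^ (1 / σ) * Λ ^ N₁), ?_⟩
  rintro Z _ _ _ ν b h bhat rfl
  have hb := dist_pos bhat
  have hA := h.one_le_A
  have hU := h.U_pos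
  have hR := h.R_pos
  have hκ := h.kappa
  have hΛ := h.two_le
  have hn := hn hb
  have hr : 0 < r := lt_min (by positivity) (by positivity)
  have hr1 : 2 * r ≤ dist bhat.val b := by
    have : r ≤ dist bhat.val b / 2 := min_le_left _ _
    linarith
  have hr2 : 4 * A ^ (n + 1) * r ≤ dist bhat.val b * U := by
    have : r ≤ dist bhat.val b * U / (4 * A ^ (n + 1)) := min_le_right _ _
    rw [le_div_iff₀ (by positivity)] at this
    linarith
  have hj2 : 2 * R ≤ 2 ^ j * r := by
    rw [← div_le_iff₀ hr]
    exact (le_max_right _ _).trans hj.le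
  have hc : IsComparable bhat M L := ⟨h.dist_add_one_le hn, h.inv_le_dist_add_one hn⟩
  exact ⟨_, h.isBalanced hc
    (h.le_flatteningMeasure_ball hc hn hN₂ hr hr1 hr2 ((le_max_left _ _).trans hj.le) hj2)
    (by positivity)
    (fun x => ne_top_of_le_ne_top ENNReal.ofReal_ne_top (h.flatteningMeasure_ball_le hc hN₁ x))
    (h.ballGauge_flattening_le hc hN₁)⟩

end IsGauged

/-! ### Comparison of the original distance with the twice deformed one -/

namespace IsGauged

variable {Z : Type*} [MetricSpace Z] [MeasurableSpace Z]
  {C κ σ R U A Λ B : ℝ} {ν : Measure Z} {b : Z} {bhat : Flattening b ν σ}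
  {q : Flattening b ν σ → ℝ}

local notation "u" => ballGauge b ν σ
local notation "Sph" => PreSphericalization bhat (flatteningMeasure b ν σ) σ

theorem sph_dist_le (hq : IsBalanced bhat B q) (x y : Sph) :
    dist x y ≤ (q x.val + q y.val) * dist x.val y.val := by
  have h1 := Deformed.dist_le x y
  rwa [hq.density_eq, hq.density_eq, ENNReal.toReal_ofReal (hq.q_pos _).le,
    ENNReal.toReal_ofReal (hq.q_pos _).le] at h1

/-- At comparable distances from b, doubling makes both values of q comparable to `dist x b * u
(dist x b)`, and one step in each deformation suffices since the densities cancel. -/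
theorem sph_dist_le_single (h : IsGauged C κ σ R U A Λ ν b) (hq : IsBalanced bhat B q)
    {k : ℕ} {x y : Sph} (hxy : dist x.val.val b ≤ dist y.val.val b)
    (hk : dist y.val.val b ≤ 2 ^ k * dist x.val.val b) :
    dist x y ≤ 2 * B * (1 + 2 ^ k * A ^ k) * dist x.val.val y.val.val := by
  have hx := dist_pos x.val
  have hy := dist_pos y.val
  have hux := h.pos hx
  have huy := h.pos hy
  have hB := hq.pos
  have hA := h.one_le_A
  have h1 := h.le_two_pow hx hk
  have hqx := hq.le x.val
  have hqy := hq.le y.val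
  have hqx0 := hq.q_pos x.val
  have hqy0 := hq.q_pos y.val
  have hd := h.density_anti hx hxy
  calc dist x y ≤ (q x.val + q y.val) * dist x.val y.val := sph_dist_le hq x y
    _ ≤ (q x.val + q y.val) * (((dist x.val.val b * u (dist x.val.val b))⁻¹ +
        (dist y.val.val b * u (dist y.val.val b))⁻¹) * dist x.val.val y.val.val) := by
      gcongr; exact h.flat_dist_le x.val y.val
    _ ≤ (B * (dist x.val.val b * u (dist x.val.val b)) +
        B * ((2 ^ k * dist x.val.val b) * (A ^ k * u (dist x.val.val b)))) *
        (((dist x.val.val b * u (dist x.val.val b))⁻¹ +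
        (dist x.val.val b * u (dist x.val.val b))⁻¹) * dist x.val.val y.val.val) := by
      gcongr
      exact hqy.trans (by gcongr)
    _ = _ := by field_simp; ring

theorem sph_dist_le_of_le (h : IsGauged C κ σ R U A Λ ν b) (hq : IsBalanced bhat B q)
    {k : ℕ} (hk : 2 * κ ≤ 2 ^ k) {x y : Sph} (hxy : dist x.val.val b ≤ dist y.val.val b) :
    dist x y ≤ 8 * B * (1 + 2 ^ k * A ^ k) * dist y.val.val b := by
  have hB := hq.pos
  have hA := h.one_le_A
  have hκ := h.kappa
  set S := 2 * B * (1 + 2 ^ k * A ^ k) with hS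
  have hS0 : 0 < S := by positivity
  suffices dist x y ≤ 4 * S * dist y.val.val b by
    refine this.trans_eq ?_; rw [hS]; ring
  have single : ∀ {x y : Sph}, dist x.val.val b ≤ dist y.val.val b →
      dist y.val.val b ≤ 2 * κ * dist x.val.val b → dist x y ≤ 2 * S * dist y.val.val b := by
    intro x y hxy hle
    refine (h.sph_dist_le_single hq (k := k) hxy (hle.trans (by gcongr))).trans ?_
    have := dist_triangle_right x.val.val y.val.val b
    calc S * dist x.val.val y.val.val ≤ S * (2 * dist y.val.val b) := by gcongr; linarith
      _ = _ := by ring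
  obtain ⟨n, hn⟩ := pow_unbounded_of_one_lt (dist y.val.val b / dist x.val.val b)
    (one_lt_two : (1 : ℝ) < 2)
  rw [div_lt_iff₀ (dist_pos x.val)] at hn
  induction n generalizing y with
  | zero => simp at hn; linarith
  | succ n ih =>
    have hx := dist_pos x.val
    have hy := dist_pos y.val
    rcases le_or_gt (dist y.val.val b) (2 * κ * dist x.val.val b) with hle | hlt
    · refine (single hxy hle).trans ?_
      gcongr
      norm_num
    · have hyR := h.dist_le y.val.val
      -- The chain moves from y towards b, at least halving the distance to b at every jump, so its
      -- costs sum geometrically to a multiple of the first.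
      obtain ⟨z, hz1, hz2⟩ := h.annulus (dist y.val.val b / (2 * κ)) (by positivity)
        (by rw [div_lt_iff₀ (by positivity)]; nlinarith)
      have hz2' : dist z b < dist y.val.val b / 2 :=
        hz2.trans_eq (by field_simp)
      have hzb : z ≠ b := _root_.dist_pos.1 (lt_of_lt_of_le (by positivity) hz1)
      let z' : Sph := ⟨⟨z, h.metricDensity_ne_top_iff.2 hzb⟩, by
        rw [hq.density_eq]; exact ENNReal.ofReal_ne_top⟩
      have h1 : dist z' y ≤ 2 * S * dist y.val.val b := by
        refine single (x := z') ?_ ?_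
        · change dist z b ≤ _; linarith
        · change _ ≤ 2 * κ * dist z b
          rwa [div_le_iff₀' (by positivity)] at hz1
      have h2 : dist x z' ≤ 4 * S * dist z b := by
        refine ih (y := z') ?_ ?_
        · change _ ≤ dist z b
          refine le_trans ?_ hz1
          rw [le_div_iff₀' (by positivity)]
          exact hlt.le
        · change dist z b < _
          rw [pow_succ] at hn
          linarith
      calc dist x y ≤ dist x z' + dist z' y := dist_triangle _ _ _
        _ ≤ 4 * S * (dist y.val.val b / 2) + 2 * S * dist y.val.val b := by
          refine add_le_add (h2.trans ?_) h1
          gcongr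
        _ = _ := by ring

/-- Either `dist x y` is at least half the distance of y from b and the chain bound suffices, or x
and y are at comparable distances from b and one step does. -/
theorem sph_dist_le_mul_dist (h : IsGauged C κ σ R U A Λ ν b) (hq : IsBalanced bhat B q)
    {k : ℕ} (hk : 2 * κ ≤ 2 ^ k) (x y : Sph) :
    dist x y ≤ 16 * B * (1 + 2 ^ k * A ^ k) * dist x.val.val y.val.val := by
  wlog hxy : dist x.val.val b ≤ dist y.val.val b generalizing x y
  · rw [dist_comm x y, dist_comm x.val.val]
    exact this y x (not_le.1 hxy).le
  have hB := hq.pos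
  have hA := h.one_le_A
  have hκ := h.kappa
  rcases le_or_gt (dist y.val.val b) (2 * dist x.val.val y.val.val) with hd | hd
  · calc dist x y ≤ 8 * B * (1 + 2 ^ k * A ^ k) * dist y.val.val b := h.sph_dist_le_of_le hq hk hxy
      _ ≤ 8 * B * (1 + 2 ^ k * A ^ k) * (2 * dist x.val.val y.val.val) := by gcongr
      _ = _ := by ring
  · have h1 := dist_triangle_left y.val.val b x.val.val
    refine (h.sph_dist_le_single hq (k := k) hxy ?_).trans ?_
    · calc dist y.val.val b ≤ 2 * dist x.val.val b := by linarith
        _ ≤ _ := by gcongr; linarith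
    · gcongr
      norm_num

/-- If the points are closer than `dist x b`, the lower bound at x is absorbed by `q x`. Otherwise
it says that `u (dist x b)` times the flattened distance is bounded below; then `dist x y ≤ 2 * dist
y b` and monotonicity of u bring in `q y`. -/
theorem dist_le_step (h : IsGauged C κ σ R U A Λ ν b) (hq : IsBalanced bhat B q)
    (x y : Flattening b ν σ) :
    dist x.val y.val ≤ 4 * A * B * ((q x + q y) * dist x y) := by
  wlog hxy : dist x.val b ≤ dist y.val b generalizing x y
  · rw [dist_comm x.val, dist_comm x y, add_comm (q x)]
    exact this y x (not_le.1 hxy).le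
  have hB := hq.pos
  have hA := h.one_le_A
  have hx := dist_pos x
  have hy := dist_pos y
  have hux := h.pos hx
  have hu2 := h.pos (r := 2 * dist x.val b) (by positivity)
  have hqx0 := hq.q_pos x
  have hqy0 := hq.q_pos y
  have hdb : u (2 * dist x.val b) ≤ A * u (dist x.val b) := by
    simpa using h.le_two_pow hx (n := 1) (by simp)
  have hmin : min (dist x.val y.val) (dist x.val b) ≤
      2 * A * (dist x.val b * u (dist x.val b)) * dist x y := by
    have h1 := h.le_flat_dist x y
    rw [← div_eq_mul_inv, div_le_iff₀ (by positivity)] at h1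
    refine h1.trans ?_
    calc dist x y * (2 * dist x.val b * u (2 * dist x.val b))
        ≤ dist x y * (2 * dist x.val b * (A * u (dist x.val b))) := by gcongr
      _ = _ := by ring
  rcases le_or_gt (dist x.val y.val) (dist x.val b) with hd | hd
  · rw [min_eq_left hd] at hmin
    calc dist x.val y.val ≤ 2 * A * (dist x.val b * u (dist x.val b)) * dist x y := hmin
      _ ≤ 2 * A * (B * q x) * dist x y :=
        mul_le_mul_of_nonneg_right (mul_le_mul_of_nonneg_left (hq.ge x) (by positivity))
          dist_nonneg
      _ = 2 * A * B * (q x * dist x y) := by ring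
      _ ≤ 4 * A * B * ((q x + q y) * dist x y) := by
        gcongr
        · norm_num
        · linarith
  · rw [min_eq_right hd.le] at hmin
    have h2 : 1 ≤ 2 * A * u (dist x.val b) * dist x y := by
      have : dist x.val b * 1 ≤ dist x.val b * (2 * A * u (dist x.val b) * dist x y) := by
        linarith
      exact le_of_mul_le_mul_left this hx
    have h3 := dist_triangle_right x.val y.val b
    calc dist x.val y.val ≤ 2 * dist y.val b * 1 := by linarith
      _ ≤ 2 * dist y.val b * (2 * A * u (dist x.val b) * dist x y) := by gcongr
      _ ≤ 2 * dist y.val b * (2 * A * u (dist y.val b) * dist x y) := by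
        have := h.mono (σ := σ) hxy
        gcongr
      _ = 4 * A * (dist y.val b * u (dist y.val b)) * dist x y := by ring
      _ ≤ 4 * A * (B * q y) * dist x y :=
        mul_le_mul_of_nonneg_right (mul_le_mul_of_nonneg_left (hq.ge y) (by positivity))
          dist_nonneg
      _ = 4 * A * B * (q y * dist x y) := by ring
      _ ≤ 4 * A * B * ((q x + q y) * dist x y) := by gcongr; linarith

theorem dist_le_mul_sph_dist (h : IsGauged C κ σ R U A Λ ν b) (hq : IsBalanced bhat B q)
    (x y : Sph) : dist x.val.val y.val.val ≤ 4 * A * B * dist x y := by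
  have hB := hq.pos
  have hA := h.one_le_A
  have hK : 0 < 4 * A * B := by positivity
  have hstep := h.dist_le_step hq
  have hlip : ∀ a c : Flattening b ν σ,
      dist (dist x.val.val a.val / (4 * A * B)) (dist x.val.val c.val / (4 * A * B)) ≤
        dist a.val c.val / (4 * A * B) := by
    intro a c
    rw [Real.dist_eq, ← sub_div, abs_div, abs_of_pos hK]
    gcongr
    simpa [dist_comm] using abs_dist_sub_le a.val c.val x.val.val
  have key := Deformed.le_dist (w := metricDensity bhat (flatteningMeasure b ν σ) 1 σ)
    (fun z => dist x.val.val z.val / (4 * A * B)) ?_ ?_ x y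
  · rw [dist_self, zero_div, Real.dist_eq, zero_sub, abs_neg, abs_of_nonneg (by positivity),
      div_le_iff₀ hK] at key
    linarith
  · intro a c hac
    have h1 := hstep a c
    rw [hac, mul_zero, mul_zero] at h1
    refine le_antisymm ((hlip a c).trans ?_) dist_nonneg
    exact div_nonpos_of_nonpos_of_nonneg h1 hK.le
  · intro a c _ _
    rw [hq.density_eq, hq.density_eq, ENNReal.toReal_ofReal (hq.q_pos _).le,
      ENNReal.toReal_ofReal (hq.q_pos _).le]
    refine (hlip a c).trans ?_
    rw [div_le_iff₀ hK]
    linarith [hstep a c]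

end IsGauged

/-! ### The measure and the completion -/

namespace IsGauged

variable {Z : Type*} [MetricSpace Z] [MeasurableSpace Z] [BorelSpace Z]
  {C κ σ R U A Λ B : ℝ} {ν : Measure Z} {b : Z} {bhat : Flattening b ν σ}
  {q : Flattening b ν σ → ℝ}

local notation "u" => ballGauge b ν σ
local notation "Sph" => PreSphericalization bhat (flatteningMeasure b ν σ) σ

omit [BorelSpace Z] in
-- Reverse doubling forces `2 ^ n * ν {b} ^ (1 / σ) ≤ U` for every n.
theorem measure_singleton (h : IsGauged C κ σ R U A Λ ν b) : ν {b} = 0 := by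
  have hΛ := h.two_le
  have hR := h.R_pos
  by_contra hne
  have hlt : ν {b} ≠ ∞ := ne_top_of_le_ne_top (h.doubling.ball_ne_top b 1)
    (measure_mono (singleton_subset_iff.2 (mem_ball_self one_pos)))
  have ht : 0 < ν.real {b} ^ (1 / σ) := Real.rpow_pos_of_pos (ENNReal.toReal_pos hne hlt) _
  obtain ⟨n, hn⟩ := pow_unbounded_of_one_lt (U / ν.real {b} ^ (1 / σ)) (one_lt_two : (1 : ℝ) < 2)
  rw [div_lt_iff₀ ht] at hn
  have hr : 0 < R / Λ ^ n := by positivity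
  have h1 := h.reverse_pow hr n (by rw [mul_div_cancel₀]; positivity)
  have h2 : ν.real {b} ^ (1 / σ) ≤ u (R / Λ ^ n) := by
    have := h.sigma_pos
    exact Real.rpow_le_rpow measureReal_nonneg
      (measureReal_mono (singleton_subset_iff.2 (mem_ball_self hr)) (h.doubling.ball_ne_top b _))
      (by positivity)
  have h3 := h.le_top (Λ ^ n * (R / Λ ^ n))
  have h4 : 2 ^ n * ν.real {b} ^ (1 / σ) ≤ 2 ^ n * u (R / Λ ^ n) := by gcongr
  linarith

/-- Integrating the reciprocal of the first density undoes the flattening; b itself is lost, but it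
is a null set. The twice deformed measure is then compared with this integral. -/
theorem setLIntegral_inv_density (h : IsGauged C κ σ R U A Λ ν b) {E : Set Z}
    (hE : MeasurableSet E) :
    ∫⁻ x in Deformed.val ⁻¹' E, (metricDensity b ν 0 σ x.val ^ σ)⁻¹ ∂flatteningMeasure b ν σ =
      ν E := by
  have hemb := Deformed.measurableEmbedding_val h.measurableSet_density_ne_top
  have hm : Measurable fun x => metricDensity b ν 0 σ x ^ σ := h.measurable_density.pow_const σ
  have hrange : range (Deformed.val : Flattening b ν σ → Z) = {b}ᶜ := by
    ext x
    refine ⟨?_, fun hx => ⟨⟨x, h.metricDensity_ne_top_iff.2 hx⟩, rfl⟩⟩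
    rintro ⟨y, rfl⟩
    exact h.metricDensity_ne_top_iff.1 y.ne_top
  have hEb : MeasurableSet (E ∩ {b}ᶜ) := hE.inter (measurableSet_singleton b).compl
  calc _ = ∫⁻ z in E, (metricDensity b ν 0 σ z ^ σ)⁻¹
        ∂((flatteningMeasure b ν σ).map Deformed.val) :=
        (setLIntegral_map hE hm.inv hemb.measurable).symm
    _ = ∫⁻ z in E ∩ {b}ᶜ, (metricDensity b ν 0 σ z ^ σ)⁻¹
        ∂(ν.withDensity fun x => metricDensity b ν 0 σ x ^ σ) := by
        rw [flatteningMeasure, deformedMeasure, hemb.map_comap, Measure.restrict_restrict hE, hrange]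
    _ = ∫⁻ z in E ∩ {b}ᶜ, 1 ∂ν := by
        refine (setLIntegral_withDensity_eq_setLIntegral_mul ν hm hm.inv hEb).trans ?_
        refine setLIntegral_congr_fun hEb fun z hz => ?_
        have hz' : z ≠ b := hz.2
        have hp := _root_.dist_pos.2 hz'
        have hv := h.doubling.real_ball_pos b hp
        simp only [Pi.mul_apply, Pi.inv_apply, h.density_rpow hz']
        refine ENNReal.mul_inv_cancel ?_ ENNReal.ofReal_ne_top
        exact (ENNReal.ofReal_pos.2 (by positivity)).ne'
    _ = ν E := by
        rw [setLIntegral_one, ← Set.sdiff_eq, measure_sdiff_null h.measure_singleton]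

omit [BorelSpace Z] in
theorem rpow_q_le (h : IsGauged C κ σ R U A Λ ν b) (hq : IsBalanced bhat B q)
    (x : Flattening b ν σ) :
    metricDensity bhat (flatteningMeasure b ν σ) 1 σ x ^ σ ≤
      ENNReal.ofReal (B ^ σ) * (metricDensity b ν 0 σ x.val ^ σ)⁻¹ := by
  have hσ := h.sigma_pos
  have hp := h.density_pos (dist_pos x)
  rw [hq.density_eq, h.metricDensity_eq (_root_.dist_pos.1 (dist_pos x)), ← ENNReal.inv_rpow,
    ← ENNReal.ofReal_inv_of_pos hp, inv_inv, ← ENNReal.ofReal_rpow_of_pos hq.pos,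
    ← ENNReal.mul_rpow_of_nonneg _ _ hσ.le, ← ENNReal.ofReal_mul hq.pos.le]
  exact ENNReal.rpow_le_rpow (ENNReal.ofReal_le_ofReal (hq.le x)) hσ.le

omit [BorelSpace Z] in
theorem inv_density_le (h : IsGauged C κ σ R U A Λ ν b) (hq : IsBalanced bhat B q)
    (x : Flattening b ν σ) :
    (metricDensity b ν 0 σ x.val ^ σ)⁻¹ ≤
      ENNReal.ofReal (B ^ σ) * metricDensity bhat (flatteningMeasure b ν σ) 1 σ x ^ σ := by
  have hσ := h.sigma_pos
  have hp := h.density_pos (dist_pos x)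
  rw [hq.density_eq, h.metricDensity_eq (_root_.dist_pos.1 (dist_pos x)), ← ENNReal.inv_rpow,
    ← ENNReal.ofReal_inv_of_pos hp, inv_inv, ← ENNReal.ofReal_rpow_of_pos hq.pos,
    ← ENNReal.mul_rpow_of_nonneg _ _ hσ.le, ← ENNReal.ofReal_mul hq.pos.le]
  exact ENNReal.rpow_le_rpow (ENNReal.ofReal_le_ofReal (hq.ge x)) hσ.le

theorem deformedMeasure_sph (h : IsGauged C κ σ R U A Λ ν b) (hq : IsBalanced bhat B q) {E : Set Z}
    (hE : MeasurableSet E) :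
    deformedMeasure (metricDensity bhat (flatteningMeasure b ν σ) 1 σ) (flatteningMeasure b ν σ) σ
      {x : Sph | x.val.val ∈ E} =
    ∫⁻ x in Deformed.val ⁻¹' E, metricDensity bhat (flatteningMeasure b ν σ) 1 σ x ^ σ
      ∂flatteningMeasure b ν σ := by
  have hne : ∀ x, metricDensity bhat (flatteningMeasure b ν σ) 1 σ x ≠ ∞ := fun x => by
    rw [hq.density_eq]; exact ENNReal.ofReal_ne_top
  have huniv : MeasurableSet {x | metricDensity bhat (flatteningMeasure b ν σ) 1 σ x ≠ ∞} := by
    simp [hne]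
  have himg : Deformed.val '' {x : Sph | x.val.val ∈ E} = Deformed.val ⁻¹' E := by
    ext x
    refine ⟨?_, fun hx => ⟨⟨x, hne x⟩, hx, rfl⟩⟩
    rintro ⟨y, hy, rfl⟩
    exact hy
  rw [deformedMeasure_apply huniv, himg, withDensity_apply]
  exact (Deformed.measurableEmbedding_val h.measurableSet_density_ne_top).measurable hE

theorem deformedMeasure_sph_le (h : IsGauged C κ σ R U A Λ ν b) (hq : IsBalanced bhat B q)
    {E : Set Z} (hE : MeasurableSet E) :
    deformedMeasure (metricDensity bhat (flatteningMeasure b ν σ) 1 σ) (flatteningMeasure b ν σ) σ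
      {x : Sph | x.val.val ∈ E} ≤ ENNReal.ofReal (B ^ σ) * ν E := by
  rw [h.deformedMeasure_sph hq hE, ← h.setLIntegral_inv_density hE,
    ← lintegral_const_mul' _ _ ENNReal.ofReal_ne_top]
  exact lintegral_mono fun x => h.rpow_q_le hq x

theorem le_deformedMeasure_sph (h : IsGauged C κ σ R U A Λ ν b) (hq : IsBalanced bhat B q)
    {E : Set Z} (hE : MeasurableSet E) :
    ν E ≤ ENNReal.ofReal (B ^ σ) *
      deformedMeasure (metricDensity bhat (flatteningMeasure b ν σ) 1 σ) (flatteningMeasure b ν σ) σ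
        {x : Sph | x.val.val ∈ E} := by
  rw [h.deformedMeasure_sph hq hE, ← h.setLIntegral_inv_density hE,
    ← lintegral_const_mul' _ _ ENNReal.ofReal_ne_top]
  exact lintegral_mono fun x => h.inv_density_le hq x

omit [BorelSpace Z] in
theorem range_sph_val (h : IsGauged C κ σ R U A Λ ν b) (hq : IsBalanced bhat B q) :
    range (fun x : Sph => x.val.val) = {b}ᶜ := by
  ext x
  refine ⟨?_, fun hx => ⟨⟨⟨x, h.metricDensity_ne_top_iff.2 hx⟩, ?_⟩, rfl⟩⟩
  · rintro ⟨y, rfl⟩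
    exact h.metricDensity_ne_top_iff.1 y.val.ne_top
  · rw [hq.density_eq]; exact ENNReal.ofReal_ne_top

omit [BorelSpace Z] in
theorem denseRange_sph_val (h : IsGauged C κ σ R U A Λ ν b) (hq : IsBalanced bhat B q) :
    DenseRange (fun x : Sph => x.val.val) := by
  have hκ := h.kappa
  have hR := h.R_pos
  rw [DenseRange, h.range_sph_val hq]
  refine Metric.dense_iff.2 fun x r hr => ?_
  by_cases hx : x = b
  · obtain ⟨z, hz1, hz2⟩ := h.annulus (min (r / κ) (R / 2)) (by positivity)
      ((min_le_right _ _).trans_lt (by linarith))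
    refine ⟨z, ?_, ?_⟩
    · rw [mem_ball, hx]
      refine hz2.trans_le ?_
      calc κ * min (r / κ) (R / 2) ≤ κ * (r / κ) := by gcongr; exact min_le_left _ _
        _ = r := by field_simp
    · exact _root_.dist_pos.1 (lt_of_lt_of_le (by positivity) hz1)
  · exact ⟨x, mem_ball_self hr, hx⟩

omit [BorelSpace Z] in
/-- A complete space is homeomorphic to the sphericalization of its flattening. -/
theorem exists_homeomorph [CompleteSpace Z] (h : IsGauged C κ σ R U A Λ ν b)
    (hq : IsBalanced bhat B q) {K L : ℝ}
    (hK : ∀ x y : Sph, dist x y ≤ K * dist x.val.val y.val.val)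
    (hL : ∀ x y : Sph, dist x.val.val y.val.val ≤ L * dist x y) :
    ∃ Φ : Z ≃ₜ Sphericalization bhat (flatteningMeasure b ν σ) σ,
      (∀ x : Sph, Φ x.val.val = x) ∧
      ∀ x y : Z, dist (Φ x) (Φ y) ≤ K * dist x y ∧ dist x y ≤ L * dist (Φ x) (Φ y) := by
  have hlip : LipschitzWith L.toNNReal (fun x : Sph => x.val.val) :=
    LipschitzWith.of_dist_le_mul fun x y => (hL x y).trans (by gcongr; exact Real.le_coe_toNNReal L)
  have hanti : AntilipschitzWith K.toNNReal (fun x : Sph => x.val.val) :=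
    AntilipschitzWith.of_le_mul_dist fun x y =>
      (hK x y).trans (by gcongr; exact Real.le_coe_toNNReal K)
  -- The inclusion into Z is bi-Lipschitz with dense range and Z is complete, so Z is itself a
  -- completion; uniqueness of completions provides the homeomorphism.
  let pkg : AbstractCompletion Sph :=
    { space := Z
      coe := fun x => x.val.val
      uniformStruct := inferInstance
      complete := inferInstance
      separation := inferInstance
      isUniformInducing := hanti.isUniformInducing hlip.uniformContinuous
      dense := h.denseRange_sph_val hq }
  let pkg' : AbstractCompletion Sph := UniformSpace.Completion.cPkg
  let Φ : Z ≃ₜ Sphericalization bhat (flatteningMeasure b ν σ) σ :=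
    { toFun := pkg.compare pkg'
      invFun := pkg'.compare pkg
      left_inv := congr_fun (pkg'.inverse_compare pkg)
      right_inv := congr_fun (pkg.inverse_compare pkg')
      continuous_toFun := @UniformContinuous.continuous _ _ pkg.uniformStruct pkg'.uniformStruct _
        (pkg.uniformContinuous_compare pkg')
      continuous_invFun := @UniformContinuous.continuous _ _ pkg'.uniformStruct pkg.uniformStruct _
        (pkg'.uniformContinuous_compare pkg) }
  have hΦ : ∀ x : Sph, Φ x.val.val = x := fun x => pkg.compare_coe pkg' x
  refine ⟨Φ, hΦ, fun x y => ?_⟩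
  have hd := h.denseRange_sph_val hq
  refine isClosed_property2 (p := fun x y : Z => dist (Φ x) (Φ y) ≤ K * dist x y ∧
    dist x y ≤ L * dist (Φ x) (Φ y)) hd ?_ ?_ x y
  · have h1 : Continuous fun p : Z × Z => dist (Φ p.1) (Φ p.2) :=
      (Φ.continuous.comp continuous_fst).dist (Φ.continuous.comp continuous_snd)
    have h2 : Continuous fun p : Z × Z => dist p.1 p.2 := continuous_dist
    exact (isClosed_le h1 (h2.const_mul K)).inter (isClosed_le h2 (h1.const_mul L))
  · intro x y
    rw [hΦ, hΦ, UniformSpace.Completion.dist_eq]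
    exact ⟨hK x y, hL x y⟩

omit [BorelSpace Z] in
theorem range_coe_eq (h : IsGauged C κ σ R U A Λ ν b) (hq : IsBalanced bhat B q)
    {Φ : Z ≃ₜ Sphericalization bhat (flatteningMeasure b ν σ) σ}
    (hΦ : ∀ x : Sph, Φ x.val.val = x) :
    range ((↑) : Sph → Sphericalization bhat (flatteningMeasure b ν σ) σ) = {Φ b}ᶜ := by
  rw [← image_singleton, ← image_compl_eq Φ.bijective, ← h.range_sph_val hq, ← range_comp]
  exact congrArg range (funext fun x => (hΦ x).symm)

/-- The coercion into the completion is Φ after the inclusion into Z, hence measurable, and the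
preimage of `Φ '' E` is read off by injectivity. -/
theorem sphericalizationMeasure_image
    {Φ : Z ≃ₜ Sphericalization bhat (flatteningMeasure b ν σ) σ}
    (hΦ : ∀ x : Sph, Φ x.val.val = x) {E : Set Z} (hE : MeasurableSet E) :
    sphericalizationMeasure bhat (flatteningMeasure b ν σ) σ (Φ '' E) =
      deformedMeasure (metricDensity bhat (flatteningMeasure b ν σ) 1 σ)
        (flatteningMeasure b ν σ) σ {x : Sph | x.val.val ∈ E} := by
  have : BorelSpace (Sphericalization bhat (flatteningMeasure b ν σ) σ) := ⟨rfl⟩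
  have hcoe : ((↑) : Sph → Sphericalization bhat (flatteningMeasure b ν σ) σ) =
      fun x => Φ x.val.val := funext fun x => (hΦ x).symm
  have hmeas : Measurable ((↑) : Sph → Sphericalization bhat (flatteningMeasure b ν σ) σ) := by
    rw [hcoe]
    exact Φ.continuous.measurable.comp ((comap_measurable _).comp (comap_measurable _))
  rw [sphericalizationMeasure,
    Measure.map_apply hmeas (Φ.measurableEmbedding.measurableSet_image.2 hE), hcoe]
  congr 1
  ext x
  exact Φ.injective.mem_set_image

end IsGauged

end

/-! ### The main theorem -/

theorem theorem7p4 (Cν κ σ R V β : ℝ) (hσ : 0 < σ) :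
    ∃ C : ℝ, 0 < C ∧
      ∀ (Z : Type*) [MetricSpace Z] [CompleteSpace Z] [Nontrivial Z]
        [MeasurableSpace Z] [BorelSpace Z] (ν : Measure Z) (b : Z),
        IsDoublingWith ν Cν →
        IsUniformlyPerfectAt b κ →
        -- `Z` is bounded and `R` is the supremum of the distances to `b`
        IsLUB (range fun x : Z => dist x b) R →
        ν univ = ENNReal.ofReal V →
        ∀ bhat : Flattening b ν σ, dist bhat.val b = β →
        ∃ Φ : Z ≃ₜ Sphericalization bhat (flatteningMeasure b ν σ) σ,
          -- `Φ` is the identity on `Z \ {b}`, and sends `b` to the only added point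
          (∀ x : PreSphericalization bhat (flatteningMeasure b ν σ) σ, Φ x.val.val = x) ∧
          range ((↑) : PreSphericalization bhat (flatteningMeasure b ν σ) σ →
            Sphericalization bhat (flatteningMeasure b ν σ) σ) = {Φ b}ᶜ ∧
          (∀ x y : Z, dist (Φ x) (Φ y) ≤ C * dist x y ∧ dist x y ≤ C * dist (Φ x) (Φ y)) ∧
          ∀ E : Set Z, MeasurableSet E →
            sphericalizationMeasure bhat (flatteningMeasure b ν σ) σ (Φ '' E) ≤
                ENNReal.ofReal C * ν E ∧
              ν E ≤ ENNReal.ofReal C *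
                sphericalizationMeasure bhat (flatteningMeasure b ν σ) σ (Φ '' E) := by
  -- The constant precedes the space, so parameters that no space can satisfy are set aside with an
  -- arbitrary constant.
  by_cases hpar : 1 < Cν ∧ 1 < κ
  swap
  · exact ⟨1, one_pos, fun Z _ _ _ _ _ ν b hD hP => absurd ⟨hD.1, hP.1⟩ hpar⟩
  obtain ⟨Λ, hΛ⟩ := IsDoublingWith.exists_isGauged Cν κ σ R V hσ hpar.1 hpar.2
  obtain ⟨B, hB⟩ := IsGauged.exists_isBalanced Cν κ σ R (V ^ (1 / σ)) (Cν ^ (1 / σ)) Λ β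
  obtain ⟨k, hk⟩ := pow_unbounded_of_one_lt (2 * κ) (one_lt_two : (1 : ℝ) < 2)
  set A := Cν ^ (1 / σ)
  set K := 16 * B * (1 + 2 ^ k * A ^ k)
  set L := 4 * A * B
  set C := max 1 (max (max K L) (B ^ σ))
  have hKC : K ≤ C := (le_max_left K L).trans ((le_max_left _ _).trans (le_max_right _ _))
  have hLC : L ≤ C := (le_max_right K L).trans ((le_max_left _ _).trans (le_max_right _ _))
  have hBC : B ^ σ ≤ C := (le_max_right _ _).trans (le_max_right _ _)
  refine ⟨C, one_pos.trans_le (le_max_left _ _), ?_⟩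
  intro Z _ _ _ _ _ ν b hD hP hR hV bhat hb
  have h := hΛ hD hP hR hV
  obtain ⟨q, hq⟩ := hB h bhat hb
  obtain ⟨Φ, hΦ, hdist⟩ := h.exists_homeomorph hq (h.sph_dist_le_mul_dist hq hk.le)
    (h.dist_le_mul_sph_dist hq)
  refine ⟨Φ, hΦ, h.range_coe_eq hq hΦ, fun x y => ⟨(hdist x y).1.trans ?_, (hdist x y).2.trans ?_⟩,
    fun E hE => ?_⟩
  · gcongr
  · gcongr
  rw [IsGauged.sphericalizationMeasure_image hΦ hE]
  exact ⟨(h.deformedMeasure_sph_le hq hE).trans (by gcongr),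
    (h.le_deformedMeasure_sph hq hE).trans (by gcongr)⟩
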